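/- Let $R$ be an associative ring with unity. Modules are left $R$-modules and complexes $X=(\cdots\to X_{l+1}\to X_l\to X_{l-1}\to\cdots)$ are complexes of left $R$-modules, indexed by $\mathbb{Z}$. Put $\mathrm{C}_n(X)=\mathrm{Coker}(X_{n+1}\to X_n)$, $\inf X=\inf\{l\mid \mathrm{H}_l(X)\neq 0\}$ and $\sup X=\sup\{l\mid \mathrm{H}_l(X)\ne 0\}$ in $\mathbb{Z}\cup\{\pm\infty\}$ (so $\inf X=\infty$ and $\sup X=-\infty$ if $X$ is exact). A complex is homologically bounded below (homologically bounded) if $\mathrm{H}_l(X)=0$ for $l\ll 0$ (for $|l|\gg 0$). Write $X\simeq Y$ if $X$ and $Y$ are isomorphic in the derived category, i.e. if there are quasi-isomorphisms $X\leftarrow Z\to Y$. A DG-projective resolution of $X$ is a quasi-isomorphism $P\to X$ such that all $P_l$ are projective and every morphism from $P$ to an exact complex is null-homotopic; $\mathrm{RHom}_R(X,U)$ is the complex $\mathrm{Hom}_R(P,U)$, with $\mathrm{Hom}_R(P,U)_l=\prod_q \mathrm{Hom}_R(P_q,U_{q+l})$. A module is regarded as a complex concentrated in degree $0$. A complex $T$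 is totally $\mathcal F$-acyclic if it is exact, all $T_l$ are projective, and $\mathrm{Hom}_R(T,F)$ is exact for every flat module $F$. A module is Ding projective if it is isomorphic to $\mathrm{C}_0(T)$ for some totally $\mathcal F$-acyclic complex $T$. An $\mathcal F$-complete resolution of $X$ is a diagram $T\xrightarrow{\tau}P\xrightarrow{\pi}X$ in which $\pi$ is a DG-projective resolution, $T$ is totally $\mathcal F$-acyclic and $\tau_i$ is bijective for all $i\gg 0$. The Ding projective dimension $\mathrm{Dpd}_R(X)\in\mathbb{Z}\cup\{\pm\infty\}$ is the infimum of the integers $n$ for which $X$ has an $\mathcal F$-complete resolution with $\tau_i$ bijective for each $i\ge n$. The flat dimension $\mathrm{fd}_R(U)$ is the infimum of $\sup\{l\mid F_l\neq 0\}$ over all bounded below complexes $F\simeq U$ of flat modules. **Theorem.** Let $X$ be a homologically bounded below complex with $\mathrm{Dpd}_R(X)<\infty$. For every $n\in\mathbb{Z}$ the following are equivalent: (1) $\mathrm{Dpd}_R(X)\le n$. (2) $\inf U-\inf\mathrm{RHom}_R(X,U)\le n$ for every homologically bounded complex $U$ with $\mathrm{fd}_R(U)<\infty$ and $\mathrm{H}(U)\neq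 0$. (3) $-\inf\mathrm{RHom}_R(X,F)\le n$ for every flat module $F$. (4) $\sup X\le n$, and for every bounded below complex $A\simeq X$ of Ding projective modules the module $\mathrm{C}_n(A)=\mathrm{Coker}(A_{n+1}\to A_n)$ is Ding projective. Moreover, $$\mathrm{Dpd}_R(X)=\sup\{\inf U-\inf\mathrm{RHom}_R(X,U)\mid U \text{ homologically bounded},\ \mathrm{fd}_R(U)<\infty,\ \mathrm{H}(U)\neq 0\}=\sup\{-\inf\mathrm{RHom}_R(X,F)\mid F\text{ a flat module}\},$$ where suprema are taken in $\mathbb{Z}\cup\{\pm\infty\}$. -/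

import Mathlib

open CategoryTheory CategoryTheory.Limits

open scoped TensorProduct

universe u

noncomputable section

namespace DingDim

/-! ### Flat left modules over an arbitrary associative ring -/

section Flat

variable (R : Type u) [Ring R]

/-- The subgroup of `N ⊗[ℤ] M` generated by the elements `(n r) ⊗ m - n ⊗ (r m)`, for a right
`R`-module `N` (that is, a left module over the opposite ring) and a left `R`-module `M`. -/
def balancedRel (N M : Type u) [AddCommGroup N] [Module Rᵐᵒᵖ N] [AddCommGroup M] [Module R M] :
    AddSubgroup (N ⊗[ℤ] M) :=
  AddSubgroup.closure
    {x | ∃ (n : N) (r : R) (m : M), x = (MulOpposite.op r • n) ⊗ₜ[ℤ] m - n ⊗ₜ[ℤ] (r • m)}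

/-- The tensor product `N ⊗_R M` of a right `R`-module `N` and a left `R`-module `M`. -/
abbrev BalancedTensor (N M : Type u) [AddCommGroup N] [Module Rᵐᵒᵖ N] [AddCommGroup M]
    [Module R M] : Type u :=
  (N ⊗[ℤ] M) ⧸ balancedRel R N M

variable {R}

/-- The homomorphism `f ⊗_R M : N ⊗_R M → N' ⊗_R M` induced by a homomorphism `f : N → N'` of
right `R`-modules. -/
def balancedTensorMap {N N' : Type u} [AddCommGroup N] [Module Rᵐᵒᵖ N] [AddCommGroup N']
    [Module Rᵐᵒᵖ N'] (f : N →ₗ[Rᵐᵒᵖ] N') (M : Type u) [AddCommGroup M] [Module R M] :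
    BalancedTensor R N M →+ BalancedTensor R N' M :=
  QuotientAddGroup.map (balancedRel R N M) (balancedRel R N' M)
    (LinearMap.rTensor M f.toAddMonoidHom.toIntLinearMap).toAddMonoidHom (by
      rw [balancedRel, AddSubgroup.closure_le]
      rintro _ ⟨n, r, m, rfl⟩
      refine AddSubgroup.subset_closure ⟨f n, r, m, ?_⟩
      simp)

variable (R) in
/-- A left `R`-module `M` is flat if `- ⊗_R M` preserves injectivity of homomorphisms of right
`R`-modules. -/
def IsFlat (M : Type u) [AddCommGroup M] [Module R M] : Prop :=
  ∀ (N N' : Type u) [AddCommGroup N] [Module Rᵐᵒᵖ N] [AddCommGroup N'] [Module Rᵐᵒᵖ N']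
    (f : N →ₗ[Rᵐᵒᵖ] N'), Function.Injective f → Function.Injective (balancedTensorMap f M)

end Flat

/-! ### Complexes with homological indexing

Complexes are Mathlib's complexes `CochainComplex V ℤ`; the component of homological degree `l`
is the one of cohomological degree `-l`, so that the differential lowers the degree `l` by one. -/

section Complexes

variable {V : Type*} [Category V] [Abelian V]

/-- The component `X_l`. -/
abbrev comp (X : CochainComplex V ℤ) (l : ℤ) : V := X.X (-l)

/-- The homology `H_l(X)`. -/
abbrev hl (X : CochainComplex V ℤ) (l : ℤ) : V := X.homology (-l)

/-- The cokernel `C_l(X) = Coker (X_{l+1} → X_l)`. -/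
abbrev coker (X : CochainComplex V ℤ) (l : ℤ) : V := cokernel (X.d (-(l + 1)) (-l))

/-- `X_l = 0` for all `l ≪ 0`. -/
def BoundedBelow (X : CochainComplex V ℤ) : Prop := ∃ N : ℤ, ∀ l < N, IsZero (comp X l)

/-- `H_l(X) = 0` for all `l ≪ 0`. -/
def HomologicallyBoundedBelow (X : CochainComplex V ℤ) : Prop :=
  ∃ N : ℤ, ∀ l < N, IsZero (hl X l)

/-- `H_l(X) = 0` for all `l ≫ 0`. -/
def HomologicallyBoundedAbove (X : CochainComplex V ℤ) : Prop :=
  ∃ N : ℤ, ∀ l > N, IsZero (hl X l)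

/-- `H_l(X) = 0` for all `|l| ≫ 0`. -/
def HomologicallyBounded (X : CochainComplex V ℤ) : Prop :=
  HomologicallyBoundedBelow X ∧ HomologicallyBoundedAbove X

/-- `H(X) ≠ 0`. -/
def HomologyNonzero (X : CochainComplex V ℤ) : Prop := ∃ l : ℤ, ¬ IsZero (hl X l)

/-- An integer as an extended real number. -/
def toE (n : ℤ) : EReal := ((n : ℝ) : EReal)

/-- `inf X = inf {l | H_l(X) ≠ 0}`, which is `⊤` if `X` is exact. -/
def infH (X : CochainComplex V ℤ) : EReal := sInf (toE '' {l : ℤ | ¬ IsZero (hl X l)})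

/-- `sup X = sup {l | H_l(X) ≠ 0}`, which is `⊥` if `X` is exact. -/
def supH (X : CochainComplex V ℤ) : EReal := sSup (toE '' {l : ℤ | ¬ IsZero (hl X l)})

/-- `sup {l | X_l ≠ 0}`. -/
def supComp (X : CochainComplex V ℤ) : EReal := sSup (toE '' {l : ℤ | ¬ IsZero (comp X l)})

/-- `X ≃ Y`: the two complexes are isomorphic in the derived category, that is, they are linked by
quasi-isomorphisms `X ← Z → Y`. -/
def Equivalent (X Y : CochainComplex V ℤ) : Prop :=
  ∃ (Z : CochainComplex V ℤ) (f : Z ⟶ X) (g : Z ⟶ Y), QuasiIso f ∧ QuasiIso g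

end Complexes

/-! ### Complexes of left `R`-modules -/

section Modules

variable {R : Type u} [Ring R]

variable (R) in
/-- Complexes of left `R`-modules. -/
abbrev Cplx := CochainComplex (ModuleCat.{u} R) ℤ

/-- The complex with `M` in degree zero and `0` in the other degrees. -/
abbrev stalk (M : ModuleCat.{u} R) : Cplx R :=
  (CochainComplex.singleFunctor (ModuleCat.{u} R) 0).obj M

/-- The complex `Hom_R(X, Y)` of abelian groups, with
`Hom_R(X, Y)_l = ∏_q Hom_R(X_q, Y_{q+l})`. -/
abbrev homCplx (X Y : Cplx R) : CochainComplex AddCommGrpCat.{u} ℤ :=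
  CochainComplex.HomComplex X Y

/-- A DG-projective complex: all its components are projective, and every morphism from it to an
exact complex is null-homotopic. -/
def DGProjective (P : Cplx R) : Prop := (∀ l, Projective (comp P l)) ∧ P.IsKProjective

/-- A DG-projective resolution of `X`: a quasi-isomorphism `P → X` with `P` DG-projective. -/
structure DGProjectiveResolution (X : Cplx R) where
  P : Cplx R
  π : P ⟶ X
  dgProjective : DGProjective P
  quasiIso : QuasiIso π

/-- The complex `RHom_R(X, U)`, computed as `Hom_R(P, U)` with a DG-projective resolution
`P → X`. -/
abbrev RHom {X : Cplx R} (ρ : DGProjectiveResolution X) (U : Cplx R) :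
    CochainComplex AddCommGrpCat.{u} ℤ :=
  homCplx ρ.P U

/-- `inf RHom_R(X, U)`. The value of `infH (RHom ρ U)` is the same for all DG-projective
resolutions `ρ` of `X`, and the infimum over `ρ` is this common value. -/
def infRHom (X U : Cplx R) : EReal := ⨅ ρ : DGProjectiveResolution X, infH (RHom ρ U)

/-- Totally `ℱ`-acyclic complexes, where `ℱ` is the class of flat left `R`-modules. -/
structure TotallyFAcyclic (T : Cplx R) : Prop where
  projective : ∀ l, Projective (comp T l)
  acyclic : T.Acyclic
  hom_acyclic : ∀ F : ModuleCat.{u} R, IsFlat R F → (homCplx T (stalk F)).Acyclic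

/-- Ding projective modules. -/
def DingProjective (M : ModuleCat.{u} R) : Prop :=
  ∃ T : Cplx R, TotallyFAcyclic T ∧ Nonempty (coker T 0 ≅ M)

/-- An `ℱ`-complete resolution `T → P → X`: `P → X` is a DG-projective resolution, `T` is totally
`ℱ`-acyclic and `τ_i : T_i → P_i` is bijective for all `i ≫ 0`. -/
structure FCompleteResolution (X : Cplx R) where
  T : Cplx R
  res : DGProjectiveResolution X
  τ : T ⟶ res.P
  totallyFAcyclic : TotallyFAcyclic T
  eventually_bijective : ∃ N : ℤ, ∀ i ≥ N, Function.Bijective (τ.f (-i))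

/-- The Ding projective dimension `Dpd_R(X)`: the infimum of the integers `n` for which there is
an `ℱ`-complete resolution of `X` with `τ_i` bijective for each `i ≥ n`. -/
def Dpd (X : Cplx R) : EReal :=
  sInf (toE '' {n : ℤ | ∃ ρ : FCompleteResolution X,
    ∀ i ≥ n, Function.Bijective (ρ.τ.f (-i))})

/-- The flat dimension `fd_R(U)`: the infimum of `sup {l | F_l ≠ 0}` over the bounded below
complexes `F ≃ U` of flat modules. -/
def flatDim (U : Cplx R) : EReal :=
  sInf (supComp '' {F : Cplx R |
    Equivalent F U ∧ BoundedBelow F ∧ ∀ l, IsFlat R (comp F l : ModuleCat.{u} R)})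

/-- Homologically bounded complexes of finite flat dimension with nonzero homology. -/
def FiniteFlatNonzero (U : Cplx R) : Prop :=
  HomologicallyBounded U ∧ flatDim U < ⊤ ∧ HomologyNonzero U

end Modules

end DingDim

end

/-! The conditions are linked as (1) ⇒ (2) ⇒ (3) ⇒ (1) and (1) ⇒ (4) ⇒ (3). Write `K^p = K_{-p}`, so
that homological degrees `≥ n` are cohomological degrees `≤ -n`; comments on the proof use the
latter.

The heart is (3) ⇒ (1), `exists_totallyFAcyclic_of_homExactAt`. Finiteness of `Dpd` provides some
complete resolution `τ : T → P`, bijective in all sufficiently low degrees. There the cone `C` of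
`τ` carries a contraction. Condition (3) makes `Hom(C, F)` exact in degrees below `-n` for every
flat `F`. The components of `C` are projective, hence flat, so they are admissible coefficients, and
the contraction extends degree by degree up to `-n`. Splitting an idempotent then gives `C'`,
homotopy equivalent to `C` and zero below `-n`. The cocone of `P → C → C'` is homotopy equivalent to
`T`, hence totally `ℱ`-acyclic, and maps bijectively to `P` in degrees `≤ -n`.

For (1) ⇒ (2), replace `U` by a bounded complex of flats and truncate it at `inf U`. The end term of
the truncation need not be flat, but `Hom(T, -)` is still exact on it, because such coefficients are
closed under kernels of epimorphisms. As `T` and `P` agree in the relevant degrees, cocycles in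
`Hom(P, U)` can be bounded one component at a time. Stalks of nonzero flat modules give (2) ⇒ (3).

For (1) ⇒ (4), `C_n(P) ≅ C_n(T)` is Ding projective, and the cone of a quasi-isomorphism `P → A`
compares `C_n(P)` with `C_n(A)`. This needs closure of Ding projectives under extensions and kernels
of epimorphisms, which rests on the coinduction principle `dingProjective_of_class`. For (4) ⇒ (3),
take `A` to be a bounded below projective resolution: vanishing of `Ext(C_n(A), F)` passes to higher
syzygies and yields exactness of `Hom(A, F)`.

The formulas for `Dpd` follow by letting `n` vary, since all quantities involved are extended
integers. -/

noncomputable section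

namespace DingDim

/-! ### Projective modules are flat over a noncommutative ring -/

section FlatModules

variable {R : Type u} [Ring R]

/-- Contraction `N ⊗_R M → N` along a linear form `φ : M → R`. -/
def contractForm (N : Type u) {M : Type u} [AddCommGroup N] [Module Rᵐᵒᵖ N] [AddCommGroup M]
    [Module R M] (φ : M →ₗ[R] R) : BalancedTensor R N M →+ N :=
  QuotientAddGroup.lift (balancedRel R N M)
    (TensorProduct.lift
      (AddMonoidHom.toIntLinearMap
        { toFun := fun n => AddMonoidHom.toIntLinearMap
            { toFun := fun m => MulOpposite.op (φ m) • n
              map_zero' := by simp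
              map_add' := fun x y => by simp [add_smul] }
          map_zero' := by ext; simp
          map_add' := fun x y => by ext; simp })).toAddMonoidHom (by
      rw [balancedRel, AddSubgroup.closure_le]
      rintro _ ⟨n, r, m, rfl⟩
      simp [mul_smul])

lemma contractForm_mk {N M : Type u} [AddCommGroup N] [Module Rᵐᵒᵖ N] [AddCommGroup M]
    [Module R M] (φ : M →ₗ[R] R) (n : N) (m : M) :
    contractForm N φ (QuotientAddGroup.mk (n ⊗ₜ[ℤ] m)) = MulOpposite.op (φ m) • n := rfl

lemma balancedTensor_induction {N M : Type u} [AddCommGroup N] [Module Rᵐᵒᵖ N] [AddCommGroup M]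
    [Module R M] {p : BalancedTensor R N M → Prop} (h0 : p 0)
    (hmk : ∀ n m, p (QuotientAddGroup.mk (n ⊗ₜ[ℤ] m)))
    (hadd : ∀ x y, p x → p y → p (x + y)) (x : BalancedTensor R N M) : p x := by
  obtain ⟨x, rfl⟩ := QuotientAddGroup.mk_surjective x
  induction x using TensorProduct.induction_on with
  | zero => exact h0
  | tmul n m => exact hmk n m
  | add x y hx hy => exact hadd _ _ hx hy

lemma balanced_mk_smul {N M : Type u} [AddCommGroup N] [Module Rᵐᵒᵖ N] [AddCommGroup M]
    [Module R M] (n : N) (r : R) (m : M) :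
    (QuotientAddGroup.mk (n ⊗ₜ[ℤ] (r • m)) : BalancedTensor R N M) =
      QuotientAddGroup.mk ((MulOpposite.op r • n) ⊗ₜ[ℤ] m) := by
  refine (QuotientAddGroup.eq.2 ?_)
  refine AddSubgroup.subset_closure ⟨n, r, m, ?_⟩
  abel

lemma contractForm_balancedTensorMap {N N' M : Type u} [AddCommGroup N] [Module Rᵐᵒᵖ N]
    [AddCommGroup N'] [Module Rᵐᵒᵖ N'] [AddCommGroup M] [Module R M] (f : N →ₗ[Rᵐᵒᵖ] N')
    (φ : M →ₗ[R] R) (x : BalancedTensor R N M) :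
    contractForm N' φ (balancedTensorMap f M x) = f (contractForm N φ x) := by
  induction x using balancedTensor_induction with
  | h0 => simp
  | hmk n m => simp [balancedTensorMap, contractForm_mk]
  | hadd x y hx hy => simp [hx, hy]

/-- In a projective module, a tensor is recovered from its contractions along the coordinate
forms of a dual basis. -/
lemma exists_sum_contractForm {N M : Type u} [AddCommGroup N] [Module Rᵐᵒᵖ N] [AddCommGroup M]
    [Module R M] (s : M →ₗ[R] (M →₀ R)) (hs : Finsupp.linearCombination R id ∘ₗ s = LinearMap.id)
    (x : BalancedTensor R N M) :
    ∃ t : Finset M, ∀ t' : Finset M, t ⊆ t' →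
      x = ∑ i ∈ t', QuotientAddGroup.mk (contractForm N (Finsupp.lapply i ∘ₗ s) x ⊗ₜ[ℤ] i) := by
  classical
  induction x using balancedTensor_induction with
  | h0 => exact ⟨∅, fun t' _ => by simp⟩
  | hmk n m =>
    refine ⟨(s m).support, fun t' ht' => ?_⟩
    have hm : m = ∑ i ∈ t', (s m) i • i := by
      conv_lhs => rw [← LinearMap.id_apply (R := R) m, ← hs]
      simp only [LinearMap.comp_apply, Finsupp.linearCombination_apply]
      exact Finsupp.sum_of_support_subset _ ht' _ (by simp)
    conv_lhs => rw [hm, TensorProduct.tmul_sum]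
    rw [show (QuotientAddGroup.mk (∑ i ∈ t', n ⊗ₜ[ℤ] ((s m) i • i)) : BalancedTensor R N M) =
      ∑ i ∈ t', QuotientAddGroup.mk (n ⊗ₜ[ℤ] ((s m) i • i)) from
        map_sum (QuotientAddGroup.mk' _) _ _]
    refine Finset.sum_congr rfl fun i _ => ?_
    rw [balanced_mk_smul, contractForm_mk]
    rfl
  | hadd x y hx hy =>
    obtain ⟨t₁, h₁⟩ := hx
    obtain ⟨t₂, h₂⟩ := hy
    -- Allowing every finite set containing `t` lets the two expansions be summed over a common
    -- index set.
    refine ⟨t₁ ∪ t₂, fun t' ht' => ?_⟩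
    conv_lhs => rw [h₁ t' (Finset.union_subset_left ht'), h₂ t' (Finset.union_subset_right ht')]
    rw [← Finset.sum_add_distrib]
    refine Finset.sum_congr rfl fun i _ => ?_
    rw [map_add, TensorProduct.add_tmul]
    rfl

/-- Contraction is natural in `N`, so a tensor killed by `f ⊗ M` has all its contractions killed by
the injective `f`. They vanish, and the dual basis expansion gives zero. -/
lemma isFlat_of_moduleProjective (M : Type u) [AddCommGroup M] [Module R M]
    [Module.Projective R M] : IsFlat R M := by
  intro N N' _ _ _ _ f hf
  obtain ⟨s, hs⟩ := Module.projective_def'.1 (‹Module.Projective R M›)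
  rw [injective_iff_map_eq_zero]
  intro x hx
  obtain ⟨t, ht⟩ := exists_sum_contractForm (N := N) s hs x
  rw [ht t le_rfl]
  refine Finset.sum_eq_zero fun i _ => ?_
  have : contractForm N (Finsupp.lapply i ∘ₗ s) x = 0 := hf (by
    rw [← contractForm_balancedTensorMap, hx, map_zero, map_zero])
  rw [this, TensorProduct.zero_tmul]
  rfl

lemma isFlat_of_projective (M : ModuleCat.{u} R) [Projective M] : IsFlat R M := by
  have := (IsProjective.iff_projective (R := R) M).2 ‹Projective M›
  exact isFlat_of_moduleProjective M

/-- Functoriality of `N ⊗_R M` in `M`. -/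
def balancedTensorMapRight (N : Type u) [AddCommGroup N] [Module Rᵐᵒᵖ N] {M M' : Type u}
    [AddCommGroup M] [Module R M] [AddCommGroup M'] [Module R M'] (g : M →ₗ[R] M') :
    BalancedTensor R N M →+ BalancedTensor R N M' :=
  QuotientAddGroup.map (balancedRel R N M) (balancedRel R N M')
    (LinearMap.lTensor N g.toAddMonoidHom.toIntLinearMap).toAddMonoidHom (by
      rw [balancedRel, AddSubgroup.closure_le]
      rintro _ ⟨n, r, m, rfl⟩
      refine AddSubgroup.subset_closure ⟨n, r, g m, ?_⟩
      simp)

lemma balancedTensorMapRight_mk {N M M' : Type u} [AddCommGroup N] [Module Rᵐᵒᵖ N]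
    [AddCommGroup M] [Module R M] [AddCommGroup M'] [Module R M'] (g : M →ₗ[R] M') (n : N) (m : M) :
    balancedTensorMapRight N g (QuotientAddGroup.mk (n ⊗ₜ[ℤ] m)) =
      QuotientAddGroup.mk (n ⊗ₜ[ℤ] g m) := rfl

lemma IsFlat.of_iso {M M' : ModuleCat.{u} R} (hM : IsFlat R M) (e : M ≅ M') : IsFlat R M' := by
  intro N N' _ _ _ _ f hf x y hxy
  have key (z : BalancedTensor R N M') :
      balancedTensorMapRight N e.hom.hom (balancedTensorMapRight N e.inv.hom z) = z := by
    induction z using balancedTensor_induction with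
    | h0 => simp
    | hmk n m =>
      rw [balancedTensorMapRight_mk, balancedTensorMapRight_mk]
      simp
    | hadd x y hx hy => simp [hx, hy]
  have comm (z : BalancedTensor R N M') :
      balancedTensorMap f M (balancedTensorMapRight N e.inv.hom z) =
        balancedTensorMapRight N' e.inv.hom (balancedTensorMap f M' z) := by
    induction z using balancedTensor_induction with
    | h0 => simp
    | hmk n m => rfl
    | hadd x y hx hy => simp [hx, hy]
  rw [← key x, ← key y]
  congr 1
  exact hM N N' f hf (by rw [comm, comm, hxy])

lemma isFlat_of_isZero (M : ModuleCat.{u} R) (hM : IsZero M) : IsFlat R M := by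
  have : Projective M := hM.projective
  exact isFlat_of_projective M

end FlatModules

open CochainComplex HomComplex

/-! ### Homology of Hom complexes and of RHom -/

section HomVanishing

variable {R : Type u} [Ring R]

lemma isZero_homCplx_homology_iff (P U : Cplx R) (m : ℤ) :
    IsZero ((homCplx P U).homology m) ↔ ∀ z : Cocycle P U m, z ∈ coboundaries P U m := by
  rw [AddCommGrpCat.isZero_iff_subsingleton,
    (homologyAddEquiv P U m).toEquiv.subsingleton_congr]
  constructor
  · intro h z
    rw [← CohomologyClass.mk_eq_zero_iff]
    exact Subsingleton.elim _ _
  · refine fun h => subsingleton_of_forall_eq 0 fun x => ?_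
    obtain ⟨z, rfl⟩ := x.mk_surjective
    exact (CohomologyClass.mk_eq_zero_iff z).2 (h z)

lemma isZero_homCplx_homology_iff_homotopyCategory (P U : Cplx R) (m : ℤ) :
    IsZero ((homCplx P U).homology m) ↔
      ∀ f : (HomotopyCategory.quotient _ _).obj P ⟶ (HomotopyCategory.quotient _ _).obj (U⟦m⟧),
        f = 0 := by
  rw [AddCommGrpCat.isZero_iff_subsingleton,
    (homologyAddEquiv P U m).toEquiv.subsingleton_congr,
    (CohomologyClass.homAddEquiv (K := P) (L := U) (n := m)).toEquiv.subsingleton_congr]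
  exact ⟨fun h f => Subsingleton.elim _ _, fun h => subsingleton_of_forall_eq 0 h⟩

-- Out of a K-projective complex, morphisms in the homotopy and derived categories agree. Vanishing
-- of the homology of `RHom` thereby becomes invariant under quasi-isomorphism in both variables.
open DerivedCategory in
lemma isZero_homCplx_homology_iff_derivedCategory [HasDerivedCategory (ModuleCat.{u} R)]
    (P U : Cplx R) [P.IsKProjective] (m : ℤ) :
    IsZero ((homCplx P U).homology m) ↔ ∀ f : Q.obj P ⟶ Q.obj (U⟦m⟧), f = 0 := by
  rw [isZero_homCplx_homology_iff_homotopyCategory]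
  have hb := IsKProjective.Qh_map_bijective P ((HomotopyCategory.quotient _ _).obj (U⟦m⟧))
  let e := quotientCompQhIso (ModuleCat.{u} R)
  constructor
  · intro h f
    obtain ⟨g, hg⟩ := hb.surjective (e.hom.app P ≫ f ≫ e.inv.app _)
    have h0 : e.hom.app P ≫ f ≫ e.inv.app (U⟦m⟧) = 0 := by
      rw [← hg, h g]; exact Functor.map_zero _ _ _
    simpa using h0
  · intro h f
    apply hb.injective
    have := h (e.inv.app P ≫ Qh.map f ≫ e.hom.app (U⟦m⟧))
    have h0 : Qh.map f = 0 := by simpa using this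
    rw [h0, Functor.map_zero]

/-- The homology of `RHom` does not depend on the resolution or on the target up to
quasi-isomorphism. -/
lemma isZero_RHom_homology_congr {X U U' : Cplx R} (ρ ρ' : DGProjectiveResolution X)
    (hU : Equivalent U U') (m : ℤ) :
    IsZero ((RHom ρ U).homology m) ↔ IsZero ((RHom ρ' U').homology m) := by
  let := HasDerivedCategory.standard (ModuleCat.{u} R)
  obtain ⟨Z, f, g, hf, hg⟩ := hU
  have := ρ.dgProjective.2
  have := ρ'.dgProjective.2
  have := ρ.quasiIso
  have := ρ'.quasiIso
  let Q := DerivedCategory.Q (C := ModuleCat.{u} R)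
  let eP : Q.obj ρ.P ≅ Q.obj ρ'.P := asIso (Q.map ρ.π) ≪≫ (asIso (Q.map ρ'.π)).symm
  let eU : Q.obj U ≅ Q.obj U' := (asIso (Q.map f)).symm ≪≫ asIso (Q.map g)
  let eU' : Q.obj (U⟦m⟧) ≅ Q.obj (U'⟦m⟧) :=
    (Q.commShiftIso m).app U ≪≫ (CategoryTheory.shiftFunctor _ m).mapIso eU ≪≫ ((Q.commShiftIso m).app U').symm
  rw [isZero_homCplx_homology_iff_derivedCategory, isZero_homCplx_homology_iff_derivedCategory]
  constructor
  · intro h f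
    have := h (eP.hom ≫ f ≫ eU'.inv)
    simpa only [Preadditive.IsIso.comp_left_eq_zero, Preadditive.IsIso.comp_right_eq_zero] using this
  · intro h f
    have := h (eP.inv ≫ f ≫ eU'.hom)
    simpa only [Preadditive.IsIso.comp_left_eq_zero, Preadditive.IsIso.comp_right_eq_zero] using this

/-- `Hom_R(K, F)` is exact at `Hom_R(K^p, F)`. -/
def HomExactAt (K : Cplx R) (F : ModuleCat.{u} R) (p : ℤ) : Prop :=
  ∀ φ : K.X p ⟶ F, K.d (p - 1) p ≫ φ = 0 → ∃ ψ : K.X (p + 1) ⟶ F, K.d p (p + 1) ≫ ψ = φ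

lemma HomExactAt.exists_eq {K : Cplx R} {F : ModuleCat.{u} R} {p : ℤ} (h : HomExactAt K F p)
    {p' p'' : ℤ} (hp' : p' + 1 = p) (hp'' : p + 1 = p'') (φ : K.X p ⟶ F) (hφ : K.d p' p ≫ φ = 0) :
    ∃ ψ : K.X p'' ⟶ F, K.d p p'' ≫ ψ = φ := by
  obtain rfl : p' = p - 1 := by lia
  subst hp''
  exact h φ hφ

/-- A cochain of degree `m` into a stalk complex has a single possibly nonzero component, at `p =
-m`, so cocycles and coboundaries are conditions on one morphism. -/
lemma isZero_homCplx_stalk_homology_iff (K : Cplx R) (F : ModuleCat.{u} R) (m p : ℤ)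
    (h : p + m = 0) : IsZero ((homCplx K (stalk F)).homology m) ↔ HomExactAt K F p := by
  rw [isZero_homCplx_homology_iff]
  constructor
  · intro H φ hφ
    exact (Cocycle.toSingleMk_mem_coboundaries_iff φ h (p - 1) (by lia) hφ _ rfl).1 (H _)
  · intro H z
    obtain ⟨φ, hφ, rfl⟩ := Cocycle.toSingleMk_surjective z p h (p - 1) (by lia)
    exact (Cocycle.toSingleMk_mem_coboundaries_iff φ h (p - 1) (by lia) hφ _ rfl).2 (H φ hφ)

lemma acyclic_homCplx_stalk_iff (K : Cplx R) (F : ModuleCat.{u} R) :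
    (homCplx K (stalk F)).Acyclic ↔ ∀ p, HomExactAt K F p := by
  constructor
  · intro h p
    exact (isZero_homCplx_stalk_homology_iff K F (-p) p (by lia)).1
      ((HomologicalComplex.exactAt_iff_isZero_homology _ _).1 (h (-p)))
  · intro h m
    exact (HomologicalComplex.exactAt_iff_isZero_homology _ _).2
      ((isZero_homCplx_stalk_homology_iff K F m (-m) (by lia)).2 (h _))

lemma TotallyFAcyclic.homExactAt {T : Cplx R} (hT : TotallyFAcyclic T) {F : ModuleCat.{u} R}
    (hF : IsFlat R F) (p : ℤ) : HomExactAt T F p :=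
  (acyclic_homCplx_stalk_iff T F).1 (hT.hom_acyclic F hF) p

lemma TotallyFAcyclic.projective_X {T : Cplx R} (hT : TotallyFAcyclic T) (p : ℤ) :
    Projective (T.X p) := by
  have := hT.projective (-p)
  rwa [comp, neg_neg] at this

lemma DGProjective.projective_X {P : Cplx R} (hP : DGProjective P) (p : ℤ) :
    Projective (P.X p) := by
  have := hP.1 (-p)
  rwa [comp, neg_neg] at this

end HomVanishing

/-! ### Vanishing of Ext against flat modules -/

section ExtVanishing

open Abelian

variable {R : Type u} [Ring R]

/-- `Ext^k(M, F) = 0` for all `k ≥ 1` and all flat modules `F`. -/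
def ExtVanish (M : ModuleCat.{u} R) : Prop :=
  ∀ F : ModuleCat.{u} R, IsFlat R F → ∀ k : ℕ, Subsingleton (Ext.{u} M F (k + 1))

lemma extVanish_of_projective (M : ModuleCat.{u} R) [Projective M] : ExtVanish M :=
  fun F _ k => Ext.subsingleton_of_projective M F k

variable {S : ShortComplex (ModuleCat.{u} R)}

lemma exists_extension (hS : S.ShortExact) {F : ModuleCat.{u} R}
    [Subsingleton (Ext.{u} S.X₃ F 1)] (φ : S.X₁ ⟶ F) : ∃ ψ : S.X₂ ⟶ F, S.f ≫ ψ = φ := by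
  obtain ⟨x, hx⟩ := Ext.contravariant_sequence_exact₁ hS F (Ext.mk₀ φ) (add_zero 1)
    (Subsingleton.elim _ _)
  obtain ⟨ψ, rfl⟩ := (Ext.mk₀_bijective _ _).2 x
  refine ⟨ψ, (Ext.mk₀_bijective _ _).1 ?_⟩
  rw [← hx, Ext.mk₀_comp_mk₀]

lemma ExtVanish.exists_extension (hS : S.ShortExact) (h : ExtVanish S.X₃) {F : ModuleCat.{u} R}
    (hF : IsFlat R F) (φ : S.X₁ ⟶ F) : ∃ ψ : S.X₂ ⟶ F, S.f ≫ ψ = φ := by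
  have : Subsingleton (Ext.{u} S.X₃ F 1) := h F hF 0
  exact DingDim.exists_extension hS φ

lemma ExtVanish.left (hS : S.ShortExact) (h₂ : ExtVanish S.X₂) (h₃ : ExtVanish S.X₃) :
    ExtVanish S.X₁ := by
  intro F hF k
  refine subsingleton_of_forall_eq 0 fun x => ?_
  have := h₃ F hF (k + 1)
  have := h₂ F hF k
  obtain ⟨y, rfl⟩ := Ext.contravariant_sequence_exact₁ hS F x (n₁ := k + 1 + 1) (by lia)
    (Subsingleton.elim _ _)
  rw [Subsingleton.elim y 0, Ext.comp_zero]

lemma ExtVanish.middle (hS : S.ShortExact) (h₁ : ExtVanish S.X₁) (h₃ : ExtVanish S.X₃) :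
    ExtVanish S.X₂ := by
  intro F hF k
  refine subsingleton_of_forall_eq 0 fun x => ?_
  have := h₃ F hF k
  have := h₁ F hF k
  obtain ⟨y, rfl⟩ := Ext.contravariant_sequence_exact₂ hS F x (Subsingleton.elim _ _)
  rw [Subsingleton.elim y 0, Ext.comp_zero]

lemma subsingleton_ext_one_of_exists_extension (hS : S.ShortExact) {F : ModuleCat.{u} R}
    [Subsingleton (Ext.{u} S.X₂ F 1)] (h : ∀ φ : S.X₁ ⟶ F, ∃ ψ : S.X₂ ⟶ F, S.f ≫ ψ = φ) :
    Subsingleton (Ext.{u} S.X₃ F 1) := by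
  refine subsingleton_of_forall_eq 0 fun x => ?_
  obtain ⟨y, rfl⟩ := Ext.contravariant_sequence_exact₃ hS F x (Subsingleton.elim _ _) (add_zero 1)
  obtain ⟨φ, rfl⟩ := (Ext.mk₀_bijective _ _).2 y
  obtain ⟨ψ, rfl⟩ := h φ
  rw [← Ext.mk₀_comp_mk₀, hS.extClass_comp_assoc]

lemma subsingleton_ext_right (hS : S.ShortExact) {F : ModuleCat.{u} R} (k : ℕ)
    [Subsingleton (Ext.{u} S.X₂ F (k + 1))] [Subsingleton (Ext.{u} S.X₁ F k)] :
    Subsingleton (Ext.{u} S.X₃ F (k + 1)) := by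
  refine subsingleton_of_forall_eq 0 fun x => ?_
  obtain ⟨y, rfl⟩ := Ext.contravariant_sequence_exact₃ hS F x (Subsingleton.elim _ _) (add_comm 1 k)
  rw [Subsingleton.elim y 0, Ext.comp_zero]

lemma ExtVanish.of_iso {M M' : ModuleCat.{u} R} (h : ExtVanish M) (e : M ≅ M') :
    ExtVanish M' := by
  intro F hF k
  refine subsingleton_of_forall_eq 0 fun x => ?_
  have := h F hF k
  have hx : (Ext.mk₀ e.inv).comp ((Ext.mk₀ e.hom).comp x (zero_add _)) (zero_add _) = x := by
    simp
  rw [← hx, Subsingleton.elim ((Ext.mk₀ e.hom).comp x (zero_add _)) 0, Ext.comp_zero]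

end ExtVanishing

/-! ### Cokernels of differentials and dimension shifting -/

section Opcycles

variable {V : Type*} [Category V] [Abelian V]

/-- The sequence `0 → C_l(K) → K_{l-1} → C_{l-1}(K) → 0`. -/
abbrev opcyclesSequence (K : CochainComplex V ℤ) (p q : ℤ) (_ : p + 1 = q) : ShortComplex V :=
  ShortComplex.mk (K.fromOpcycles p q) (K.pOpcycles q) (by
    rw [← cancel_epi (K.pOpcycles p), K.p_fromOpcycles_assoc, comp_zero,
      K.d_pOpcycles])

/-- Exactness at `p` is injectivity of `C(p) → K^q`. Exactness in the middle always holds: `d`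
factors through the epimorphism `K^p → C(p)` and `C(q)` is its cokernel. -/
lemma opcyclesSequence_shortExact (K : CochainComplex V ℤ) (p q : ℤ) (hpq : p + 1 = q)
    (hK : K.ExactAt p) : (opcyclesSequence K p q hpq).ShortExact := by
  have h₁ : Mono (K.fromOpcycles p q) := by
    obtain rfl : q = (ComplexShape.up ℤ).next p := by simp [← hpq]
    have h := (ShortComplex.exact_iff_mono_fromOpcycles _).1 hK
    have : (K.sc p).fromOpcycles = K.fromOpcycles p _ :=
      (cancel_epi (K.sc p).pOpcycles).1
        ((K.sc p).p_fromOpcycles.trans (K.p_fromOpcycles p _).symm)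
    rwa [this] at h
  refine ShortComplex.ShortExact.mk' ?_ h₁ inferInstance
  let S := ShortComplex.mk (K.d p q) (K.pOpcycles q) (K.d_pOpcycles _ _)
  have hS : S.Exact := S.exact_of_g_is_cokernel (K.opcyclesIsCokernel p q (by simp [← hpq]))
  let φ : S ⟶ opcyclesSequence K p q hpq :=
    { τ₁ := K.pOpcycles p
      τ₂ := 𝟙 _
      τ₃ := 𝟙 _
      comm₁₂ := by simp [S] }
  have : Epi φ.τ₁ := inferInstanceAs (Epi (K.pOpcycles p))
  have : IsIso φ.τ₂ := inferInstanceAs (IsIso (𝟙 _))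
  have : Mono φ.τ₃ := inferInstanceAs (Mono (𝟙 _))
  exact (ShortComplex.exact_iff_of_epi_of_isIso_of_mono φ).1 hS

/-- `C_l(K)` agrees with Mathlib's object of opcycles. -/
def cokerIsoOpcycles (K : CochainComplex V ℤ) (l p : ℤ) (h : p = -l) :
    coker K l ≅ K.opcycles p := by
  subst h
  exact (cokernelIsCokernel (K.d (-(l + 1)) (-l))).coconePointUniqueUpToIso
    (K.opcyclesIsCokernel _ _ (by simp; lia))

variable {R : Type u} [Ring R]

/-- A map vanishing on boundaries factors through `C(p)`, and `Ext¹(C(q), F) = 0` extends it along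
`C(p) → K^q`. -/
lemma homExactAt_of_extVanish_opcycles (K : Cplx R) (p q : ℤ) (hpq : p + 1 = q)
    (hK : K.ExactAt p) (h : ExtVanish (K.opcycles q)) {F : ModuleCat.{u} R} (hF : IsFlat R F) :
    HomExactAt K F p := by
  subst hpq
  intro φ hφ
  obtain ⟨ψ, hψ⟩ := ExtVanish.exists_extension (opcyclesSequence_shortExact K p _ rfl hK) h hF
    (K.descOpcycles φ (p - 1) (by simp) hφ)
  refine ⟨ψ, ?_⟩
  dsimp at hψ
  rw [← K.p_fromOpcycles, Category.assoc, hψ, K.p_descOpcycles]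

/-- `Ext¹` vanishes because maps `C(p-1) → F` extend to `K^p`; higher `Ext` shifts down along the
sequences with projective middle term. -/
lemma extVanish_opcycles (K : Cplx R) (hP : ∀ p, Projective (K.X p)) (hK : K.Acyclic)
    (h : ∀ F : ModuleCat.{u} R, IsFlat R F → ∀ p, HomExactAt K F p) (p : ℤ) :
    ExtVanish (K.opcycles p) := by
  intro F hF k
  induction k generalizing p with
  | zero =>
    have hS := opcyclesSequence_shortExact K (p - 1) p (by simp) (hK _)
    have : Subsingleton (Abelian.Ext.{u} (K.X p) F 1) := Abelian.Ext.subsingleton_of_projective _ _ 0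
    refine subsingleton_ext_one_of_exists_extension hS fun φ => ?_
    obtain ⟨ψ, hψ⟩ := (h F hF (p - 1)).exists_eq (p' := p - 2) (p'' := p) (by lia) (by lia)
      (K.pOpcycles (p - 1) ≫ φ) (by rw [K.d_pOpcycles_assoc, zero_comp])
    refine ⟨ψ, ?_⟩
    dsimp
    rw [← cancel_epi (K.pOpcycles (p - 1)), K.p_fromOpcycles_assoc, hψ]
  | succ k ih =>
    have hS := opcyclesSequence_shortExact K (p - 1) p (by simp) (hK _)
    have : Subsingleton (Abelian.Ext.{u} (K.X p) F (k + 1 + 1)) :=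
      Abelian.Ext.subsingleton_of_projective _ _ _
    have : Subsingleton (Abelian.Ext.{u} (K.opcycles (p - 1)) F (k + 1)) := ih (p - 1)
    exact subsingleton_ext_right hS (k + 1)

lemma TotallyFAcyclic.extVanish_opcycles {T : Cplx R} (hT : TotallyFAcyclic T) (p : ℤ) :
    ExtVanish (T.opcycles p) :=
  DingDim.extVanish_opcycles T hT.projective_X hT.acyclic (fun _ hF p => hT.homExactAt hF p) p

end Opcycles

/-! ### Splicing short exact sequences; coinduction for Ding projectives -/

section Coresolutions

variable {R : Type u} [Ring R]

/-- A short exact sequence `0 → M → P → M' → 0` with `P` projective. -/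
structure ProjSequence (M M' : ModuleCat.{u} R) where
  P : ModuleCat.{u} R
  i : M ⟶ P
  q : P ⟶ M'
  w : i ≫ q = 0
  shortExact : (ShortComplex.mk i q w).ShortExact
  projective : Projective P

lemma ProjSequence.mono {M M' : ModuleCat.{u} R} (s : ProjSequence M M') : Mono s.i :=
  s.shortExact.mono_f

lemma ProjSequence.epi {M M' : ModuleCat.{u} R} (s : ProjSequence M M') : Epi s.q :=
  s.shortExact.epi_g

/-- A projective cover sequence `0 → Ω M → P → M → 0`. -/
def syzygySequence (M : ModuleCat.{u} R) : ProjSequence (kernel (Projective.π M)) M where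
  P := Projective.over M
  i := kernel.ι _
  q := Projective.π M
  w := kernel.condition _
  shortExact := .mk' (ShortComplex.exact_of_f_is_kernel _ (kernelIsKernel _))
    inferInstance inferInstance
  projective := inferInstance

section Splice

variable {M : ℤ → ModuleCat.{u} R} (s : ∀ n, ProjSequence (M n) (M (n + 1)))

/-- The complex spliced from a family of short exact sequences. -/
def splice : Cplx R :=
  CochainComplex.of (fun n => (s n).P) (fun n => (s n).q ≫ (s (n + 1)).i) (fun n => by
    rw [Category.assoc, reassoc_of% (s (n + 1)).w, zero_comp, comp_zero])

lemma splice_d (n : ℤ) : (splice s).d n (n + 1) = (s n).q ≫ (s (n + 1)).i :=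
  CochainComplex.of_d (fun n => (s n).P) (fun n => (s n).q ≫ (s (n + 1)).i) n

lemma splice_exactAt (n : ℤ) : (splice s).ExactAt n := by
  obtain ⟨k, rfl⟩ : ∃ k, n = k + 1 := ⟨n - 1, by simp⟩
  rw [HomologicalComplex.exactAt_iff' _ k (k + 1) (k + 1 + 1) (by simp) (by simp)]
  -- `S₁` is the spliced piece and `S₃` the given exact sequence. Both have the same exactness as
  -- `S₂`, by an epimorphism on the left and a monomorphism on the right.
  let S₁ : ShortComplex (ModuleCat.{u} R) :=
    ShortComplex.mk ((s k).q ≫ (s (k + 1)).i) ((s (k + 1)).q ≫ (s (k + 1 + 1)).i) (by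
      rw [Category.assoc, reassoc_of% (s (k + 1)).w, zero_comp, comp_zero])
  let S₂ : ShortComplex (ModuleCat.{u} R) :=
    ShortComplex.mk (s (k + 1)).i ((s (k + 1)).q ≫ (s (k + 1 + 1)).i) (by
      rw [reassoc_of% (s (k + 1)).w, zero_comp])
  let S₃ : ShortComplex (ModuleCat.{u} R) := ShortComplex.mk _ _ (s (k + 1)).w
  let φ : S₁ ⟶ S₂ := { τ₁ := (s k).q, τ₂ := 𝟙 _, τ₃ := 𝟙 _ }
  let ψ : S₃ ⟶ S₂ := { τ₁ := 𝟙 _, τ₂ := 𝟙 _, τ₃ := (s (k + 1 + 1)).i }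
  have : Epi φ.τ₁ := (s k).epi
  have : IsIso φ.τ₂ := inferInstanceAs (IsIso (𝟙 _))
  have : Mono φ.τ₃ := inferInstanceAs (Mono (𝟙 _))
  have : Epi ψ.τ₁ := inferInstanceAs (Epi (𝟙 _))
  have : IsIso ψ.τ₂ := inferInstanceAs (IsIso (𝟙 _))
  have : Mono ψ.τ₃ := (s (k + 1 + 1)).mono
  have h₃ : S₃.Exact := (s (k + 1)).shortExact.exact
  have h₁ : S₁.Exact := (ShortComplex.exact_iff_of_epi_of_isIso_of_mono φ).2
    ((ShortComplex.exact_iff_of_epi_of_isIso_of_mono ψ).1 h₃)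
  have e : (splice s).sc' k (k + 1) (k + 1 + 1) = S₁ := by
    dsimp only [HomologicalComplex.sc', HomologicalComplex.shortComplexFunctor', S₁]
    congr 1
    · exact splice_d s k
    · exact splice_d s (k + 1)
  rw [e]
  exact h₁

lemma nonempty_splice_opcycles_iso (n : ℤ) : Nonempty ((splice s).opcycles n ≅ M (n + 1)) := by
  obtain ⟨k, rfl⟩ : ∃ k, n = k + 1 := ⟨n - 1, by simp⟩
  have := (s k).epi
  have := (s (k + 1)).epi
  have hc : IsColimit (CokernelCofork.ofπ (f := (s (k + 1)).i) (s (k + 1)).q (s (k + 1)).w) :=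
    (s (k + 1)).shortExact.gIsCokernel
  have hc' := isCokernelEpiComp hc (s k).q (h := (splice s).d k (k + 1)) (splice_d s k)
  exact ⟨((splice s).opcyclesIsCokernel k (k + 1) (by simp)).coconePointUniqueUpToIso hc'⟩

lemma splice_totallyFAcyclic (hM : ∀ n, ExtVanish (M n)) : TotallyFAcyclic (splice s) where
  projective l := (s (-l)).projective
  acyclic := splice_exactAt s
  hom_acyclic F hF := by
    rw [acyclic_homCplx_stalk_iff]
    intro p
    obtain ⟨e⟩ := nonempty_splice_opcycles_iso s (p + 1)
    exact homExactAt_of_extVanish_opcycles _ p (p + 1) rfl (splice_exactAt s p)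
      ((hM _).of_iso e.symm) hF

end Splice

/-- The family `..., B 1, B 0, A 0, A 1, ...` with `A 0` in position `1`. -/
def biSequence (A B : ℕ → ModuleCat.{u} R) : ℤ → ModuleCat.{u} R
  | .ofNat 0 => B 0
  | .ofNat (k + 1) => A k
  | .negSucc k => B (k + 1)

lemma nonempty_projSequence_biSequence {A B : ℕ → ModuleCat.{u} R}
    (hA : ∀ k, Nonempty (ProjSequence (A k) (A (k + 1))))
    (hB : ∀ k, Nonempty (ProjSequence (B (k + 1)) (B k)))
    (h₀ : Nonempty (ProjSequence (B 0) (A 0))) :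
    ∀ n, Nonempty (ProjSequence (biSequence A B n) (biSequence A B (n + 1)))
  | .ofNat 0 => h₀
  | .ofNat (k + 1) => hA k
  | .negSucc 0 => hB 0
  | .negSucc (k + 1) => hB (k + 1)

/-- Coinduction principle: a module is Ding projective if it belongs to a class of modules
without higher extensions by flat modules that is closed under suitable cosyzygies. -/
theorem dingProjective_of_class (G : ModuleCat.{u} R → Prop) (hE : ∀ M, G M → ExtVanish M)
    (hG : ∀ M, G M → ∃ M', G M' ∧ Nonempty (ProjSequence M M')) {M : ModuleCat.{u} R} (hM : G M) :
    DingProjective M := by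
  choose! next hnext hseq using hG
  let A : ℕ → ModuleCat.{u} R := fun k => next^[k] M
  let B : ℕ → ModuleCat.{u} R := fun k => (fun N => kernel (Projective.π N))^[k + 1] M
  have hA : ∀ k, G (A k) := fun k => by
    induction k with
    | zero => exact hM
    | succ k ih =>
      change G (next^[k + 1] M)
      rw [Function.iterate_succ_apply']
      exact hnext _ ih
  have hA' : ∀ k, Nonempty (ProjSequence (A k) (A (k + 1))) := fun k => by
    change Nonempty (ProjSequence _ (next^[k + 1] M))
    rw [Function.iterate_succ_apply']
    exact hseq _ (hA k)
  have hB' : ∀ k, Nonempty (ProjSequence (B (k + 1)) (B k)) := fun k => by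
    change Nonempty (ProjSequence ((fun N => kernel (Projective.π N))^[k + 1 + 1] M) _)
    rw [Function.iterate_succ_apply']
    exact ⟨syzygySequence _⟩
  have h₀ : Nonempty (ProjSequence (B 0) (A 0)) := ⟨syzygySequence M⟩
  -- The left half is made of arbitrary syzygies. They need not lie in `G`, but `Ext` vanishing is
  -- inherited, which is all that splicing requires.
  have hsyz {N N' : ModuleCat.{u} R} (h : Nonempty (ProjSequence N N')) (hN' : ExtVanish N') :
      ExtVanish N := by
    obtain ⟨s⟩ := h
    have := s.projective
    exact ExtVanish.left s.shortExact (extVanish_of_projective s.P) hN'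
  have hB : ∀ k, ExtVanish (B k) := fun k => by
    induction k with
    | zero => exact hsyz h₀ (hE _ hM)
    | succ k ih => exact hsyz (hB' k) ih
  have hAB : ∀ n, ExtVanish (biSequence A B n)
    | .ofNat 0 => hB 0
    | .ofNat (k + 1) => hE _ (hA k)
    | .negSucc k => hB (k + 1)
  have s := fun n => (nonempty_projSequence_biSequence hA' hB' h₀ n).some
  -- The cokernel in degree `0` is the term in position `1`, namely `A 0 = M`.
  obtain ⟨e⟩ := nonempty_splice_opcycles_iso s 0
  exact ⟨splice s, splice_totallyFAcyclic s hAB, ⟨cokerIsoOpcycles _ 0 0 (by simp) ≪≫ e⟩⟩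

lemma DingProjective.of_iso {M M' : ModuleCat.{u} R} (h : DingProjective M) (e : M ≅ M') :
    DingProjective M' := by
  obtain ⟨T, hT, ⟨e'⟩⟩ := h
  exact ⟨T, hT, ⟨e' ≪≫ e⟩⟩

/-- The cokernels of all degrees of `T` together form a class closed under cosyzygies, so no shift
of `T` is needed. -/
lemma TotallyFAcyclic.dingProjective_opcycles {T : Cplx R} (hT : TotallyFAcyclic T) (p : ℤ) :
    DingProjective (T.opcycles p) :=
  dingProjective_of_class (fun M => ∃ q, M = T.opcycles q)
    (by rintro _ ⟨q, rfl⟩; exact hT.extVanish_opcycles q)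
    (by
      rintro _ ⟨q, rfl⟩
      exact ⟨_, ⟨q + 1, rfl⟩, ⟨⟨T.X (q + 1), _, _, _,
        opcyclesSequence_shortExact T q (q + 1) rfl (hT.acyclic q), hT.projective_X _⟩⟩⟩) ⟨p, rfl⟩

lemma DingProjective.extVanish {M : ModuleCat.{u} R} (h : DingProjective M) : ExtVanish M := by
  obtain ⟨T, hT, ⟨e⟩⟩ := h
  exact (hT.extVanish_opcycles 0).of_iso ((cokerIsoOpcycles T 0 0 (by simp)).symm ≪≫ e)

/-- Transport of a projective sequence along isomorphisms of its outer terms. -/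
def ProjSequence.ofIso {M M' N N' : ModuleCat.{u} R} (s : ProjSequence M M') (e : M ≅ N)
    (e' : M' ≅ N') : ProjSequence N N' where
  P := s.P
  i := e.inv ≫ s.i
  q := s.q ≫ e'.hom
  w := by simp [reassoc_of% s.w]
  shortExact := ShortComplex.shortExact_of_iso
    (S₁ := ShortComplex.mk s.i s.q s.w)
    (ShortComplex.isoMk e (Iso.refl _) e' (by simp) (by simp)) s.shortExact
  projective := s.projective

lemma DingProjective.exists_cosyzygy {M : ModuleCat.{u} R} (h : DingProjective M) :
    ∃ M', DingProjective M' ∧ Nonempty (ProjSequence M M') := by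
  obtain ⟨T, hT, ⟨e⟩⟩ := h
  exact ⟨_, hT.dingProjective_opcycles 1,
    ⟨ProjSequence.ofIso ⟨T.X 1, _, _, _, opcyclesSequence_shortExact T 0 1 (by simp) (hT.acyclic 0),
      hT.projective_X _⟩ ((cokerIsoOpcycles T 0 0 (by simp)).symm ≪≫ e) (Iso.refl _)⟩⟩

lemma DingProjective.exists_syzygy {M : ModuleCat.{u} R} (h : DingProjective M) :
    ∃ M', DingProjective M' ∧ Nonempty (ProjSequence M' M) := by
  obtain ⟨T, hT, ⟨e⟩⟩ := h
  exact ⟨_, hT.dingProjective_opcycles (-1),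
    ⟨ProjSequence.ofIso ⟨T.X 0, _, _, _,
      opcyclesSequence_shortExact T (-1) 0 (by simp) (hT.acyclic (-1)), hT.projective_X _⟩
      (Iso.refl _) ((cokerIsoOpcycles T 0 0 (by simp)).symm ≪≫ e)⟩⟩

lemma dingProjective_of_projective (M : ModuleCat.{u} R) [Projective M] : DingProjective M :=
  dingProjective_of_class (fun M => Projective M) (fun M _ => extVanish_of_projective M)
    (fun M hM => ⟨ModuleCat.of R PUnit,
      (ModuleCat.isZero_of_subsingleton (ModuleCat.of R PUnit)).projective,
      ⟨⟨M, 𝟙 M, 0, by simp, .mk' ((ShortComplex.exact_iff_epi _ rfl).2 inferInstance)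
        inferInstance
        ((ModuleCat.isZero_of_subsingleton (ModuleCat.of R PUnit)).epi _), hM⟩⟩⟩)
    ‹Projective M›

end Coresolutions

/-! ### Closure of Ding projectives under extensions and kernels -/

section Closure

variable {R : Type u} [Ring R]

lemma shortExact_ofHom {A B C : Type u} [AddCommGroup A] [Module R A] [AddCommGroup B] [Module R B]
    [AddCommGroup C] [Module R C] (f : A →ₗ[R] B) (g : B →ₗ[R] C) (hf : Function.Injective f)
    (hg : Function.Surjective g) (h₀ : ∀ a, g (f a) = 0) (h : ∀ b, g b = 0 → ∃ a, f a = b) :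
    ∃ w : ModuleCat.ofHom f ≫ ModuleCat.ofHom g = 0,
      (ShortComplex.mk (ModuleCat.ofHom f) (ModuleCat.ofHom g) w).ShortExact :=
  ⟨by ext x; exact h₀ x, .mk' ((ShortComplex.moduleCat_exact_iff _).2 h)
    ((ModuleCat.mono_iff_injective _).2 hf) ((ModuleCat.epi_iff_surjective _).2 hg)⟩

lemma shortExact_apply_apply {S : ShortComplex (ModuleCat.{u} R)} (x : S.X₁) :
    S.g (S.f x) = 0 := S.moduleCat_zero_apply x

lemma exists_projSequence {M P : Type u} [AddCommGroup M] [Module R M] [AddCommGroup P]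
    [Module R P] [Module.Projective R P] (f : M →ₗ[R] P) (hf : Function.Injective f) :
    Nonempty (ProjSequence (ModuleCat.of R M) (ModuleCat.of R (P ⧸ LinearMap.range f))) := by
  obtain ⟨w, hw⟩ := shortExact_ofHom f (LinearMap.range f).mkQ hf
    (Submodule.mkQ_surjective _) (by simp) (by
      intro b hb
      rw [← LinearMap.mem_ker, Submodule.ker_mkQ] at hb
      exact hb)
  exact ⟨⟨ModuleCat.of R P, _, _, w, hw, (IsProjective.iff_projective (R := R) P).1 inferInstance⟩⟩

lemma Module.projective_of_categoryProjective (P : ModuleCat.{u} R) [Projective P] :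
    Module.Projective R P :=
  (IsProjective.iff_projective (R := R) P).2 ‹Projective P›

/-- Ding projective modules are closed under extensions. -/
theorem DingProjective.of_extension {S : ShortComplex (ModuleCat.{u} R)} (hS : S.ShortExact)
    (h₁ : DingProjective S.X₁) (h₃ : DingProjective S.X₃) : DingProjective S.X₂ := by
  refine dingProjective_of_class (fun M => ∃ S : ShortComplex (ModuleCat.{u} R), S.ShortExact ∧
    DingProjective S.X₁ ∧ DingProjective S.X₃ ∧ S.X₂ = M) ?_ ?_ ⟨S, hS, h₁, h₃, rfl⟩
  · rintro _ ⟨S, hS, h₁, h₃, rfl⟩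
    exact ExtVanish.middle hS h₁.extVanish h₃.extVanish
  · rintro _ ⟨S, hS, h₁, h₃, rfl⟩
    obtain ⟨G₁, hG₁, ⟨s₁⟩⟩ := h₁.exists_cosyzygy
    obtain ⟨G₃, hG₃, ⟨s₃⟩⟩ := h₃.exists_cosyzygy
    have := s₁.projective
    have := s₃.projective
    have := Module.projective_of_categoryProjective s₁.P
    have := Module.projective_of_categoryProjective s₃.P
    -- The projective `s₁.P` is flat, so `Ext¹(S.X₃, s₁.P) = 0` and `s₁.i` extends over `S.X₂`. As
    -- in the horseshoe lemma, `S.X₂` then embeds in `s₁.P × s₃.P` with cokernel an extension of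
    -- `G₃` by `G₁`.
    obtain ⟨a, ha⟩ := h₃.extVanish.exists_extension hS (isFlat_of_projective s₁.P) s₁.i
    have ha' (x : S.X₁) : a (S.f x) = s₁.i x := by rw [← ha]; rfl
    have hi₁ : Function.Injective s₁.i := s₁.shortExact.moduleCat_injective_f
    have hi₃ : Function.Injective s₃.i := s₃.shortExact.moduleCat_injective_f
    have hq₁ : Function.Surjective s₁.q := s₁.shortExact.moduleCat_surjective_g
    have hq₃ : Function.Surjective s₃.q := s₃.shortExact.moduleCat_surjective_g
    have hg : Function.Surjective S.g := hS.moduleCat_surjective_g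
    have hex := (ShortComplex.moduleCat_exact_iff _).1 hS.exact
    have hex₁ : ∀ x, s₁.q x = 0 → ∃ y, s₁.i y = x :=
      (ShortComplex.moduleCat_exact_iff _).1 s₁.shortExact.exact
    have hex₃ : ∀ x, s₃.q x = 0 → ∃ y, s₃.i y = x :=
      (ShortComplex.moduleCat_exact_iff _).1 s₃.shortExact.exact
    have hz₁ : ∀ x, s₁.q (s₁.i x) = 0 := fun x => ConcreteCategory.congr_hom s₁.w x
    have hz₃ : ∀ x, s₃.q (s₃.i x) = 0 := fun x => ConcreteCategory.congr_hom s₃.w x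
    let m : S.X₂ →ₗ[R] s₁.P × s₃.P := a.hom.prod (s₃.i.hom ∘ₗ S.g.hom)
    have hm (y : S.X₂) : m y = (a y, s₃.i (S.g y)) := rfl
    have hm_inj : Function.Injective m := by
      rw [injective_iff_map_eq_zero]
      intro y hy
      rw [hm, Prod.mk_eq_zero] at hy
      have hy₂ : S.g y = 0 := hi₃ (by rw [hy.2, map_zero])
      obtain ⟨x, rfl⟩ := hex y hy₂
      have : x = 0 := hi₁ (by rw [← ha', hy.1, map_zero])
      rw [this, map_zero]
    refine ⟨_, ?_, exists_projSequence m hm_inj⟩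
    let u' : s₁.P →ₗ[R] (s₁.P × s₃.P) ⧸ LinearMap.range m :=
      (LinearMap.range m).mkQ ∘ₗ LinearMap.inl R _ _
    let v : (s₁.P × s₃.P) ⧸ LinearMap.range m →ₗ[R] G₃ :=
      (LinearMap.range m).liftQ (s₃.q.hom ∘ₗ LinearMap.snd R _ _) (by
        rintro _ ⟨y, rfl⟩
        exact hz₃ _)
    have hu' (p : s₁.P) : u' p = 0 ↔ s₁.q p = 0 := by
      change (LinearMap.range m).mkQ (p, 0) = 0 ↔ _
      rw [← LinearMap.mem_ker, Submodule.ker_mkQ]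
      constructor
      · rintro ⟨y, hy⟩
        rw [hm, Prod.mk.injEq] at hy
        have hy₂ : S.g y = 0 := hi₃ (by rw [hy.2, map_zero])
        obtain ⟨x, rfl⟩ := hex y hy₂
        rw [← hy.1, ha', hz₁]
      · intro hp
        obtain ⟨x, rfl⟩ := hex₁ p hp
        refine ⟨S.f x, ?_⟩
        rw [hm, ha', shortExact_apply_apply, map_zero]
    let e : (s₁.P ⧸ LinearMap.ker s₁.q.hom) ≃ₗ[R] G₁ :=
      LinearMap.quotKerEquivOfSurjective s₁.q.hom hq₁
    let u : (s₁.P ⧸ LinearMap.ker s₁.q.hom) →ₗ[R] (s₁.P × s₃.P) ⧸ LinearMap.range m :=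
      (LinearMap.ker s₁.q.hom).liftQ u' (fun p hp => (hu' p).2 hp)
    obtain ⟨w, hw⟩ := shortExact_ofHom u v
      (by
        rw [injective_iff_map_eq_zero]
        intro x hx
        obtain ⟨p, rfl⟩ := Submodule.mkQ_surjective _ x
        exact (Submodule.Quotient.mk_eq_zero _).2 ((hu' p).1 hx))
      (by
        intro g
        obtain ⟨p, rfl⟩ := hq₃ g
        exact ⟨(LinearMap.range m).mkQ (0, p), rfl⟩)
      (by
        intro x
        obtain ⟨p, rfl⟩ := Submodule.mkQ_surjective _ x
        exact map_zero s₃.q.hom)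
      (by
        intro x hx
        obtain ⟨⟨p, p'⟩, rfl⟩ := Submodule.mkQ_surjective _ x
        obtain ⟨g, rfl⟩ := hex₃ p' hx
        obtain ⟨y, rfl⟩ := hg g
        refine ⟨Submodule.Quotient.mk (p - a y), ?_⟩
        refine (Submodule.Quotient.eq _).2 ⟨-y, ?_⟩
        rw [map_neg, hm]
        ext <;> simp)
    exact ⟨_, hw, hG₁.of_iso (LinearEquiv.toModuleIso e.symm), hG₃, rfl⟩

/-- The kernel of an epimorphism from a Ding projective module to a projective module is Ding
projective. -/
theorem DingProjective.of_shortExact_of_projective {S : ShortComplex (ModuleCat.{u} R)}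
    (hS : S.ShortExact) (h₂ : DingProjective S.X₂) [Projective S.X₃] : DingProjective S.X₁ := by
  -- The cosyzygy constructed for such a kernel is already Ding projective, so the class must
  -- include those modules too.
  refine dingProjective_of_class (fun M => DingProjective M ∨ ∃ S : ShortComplex (ModuleCat.{u} R),
    S.ShortExact ∧ DingProjective S.X₂ ∧ Projective S.X₃ ∧ S.X₁ = M) ?_ ?_
    (.inr ⟨S, hS, h₂, ‹_›, rfl⟩)
  · rintro _ (h | ⟨S, hS, h₂, h₃, rfl⟩)
    · exact h.extVanish
    · exact ExtVanish.left hS h₂.extVanish (extVanish_of_projective _)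
  · rintro _ (h | ⟨S, hS, h₂, h₃, rfl⟩)
    · obtain ⟨M', h, h'⟩ := h.exists_cosyzygy
      exact ⟨M', .inl h, h'⟩
    obtain ⟨G, hG, ⟨s⟩⟩ := h₂.exists_cosyzygy
    have := s.projective
    have := Module.projective_of_categoryProjective s.P
    have hi : Function.Injective s.i := s.shortExact.moduleCat_injective_f
    have hq : Function.Surjective s.q := s.shortExact.moduleCat_surjective_g
    have hf : Function.Injective S.f := hS.moduleCat_injective_f
    have hg : Function.Surjective S.g := hS.moduleCat_surjective_g
    have hex := (ShortComplex.moduleCat_exact_iff _).1 hS.exact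
    have hex' : ∀ x, s.q x = 0 → ∃ y, s.i y = x :=
      (ShortComplex.moduleCat_exact_iff _).1 s.shortExact.exact
    have hz : ∀ x, s.q (s.i x) = 0 := fun x => ConcreteCategory.congr_hom s.w x
    -- Viewing `X₁ ⊆ X₂ ⊆ P`, the cokernel `P / X₁` is an extension of `P / X₂ ≅ G` by `X₂ / X₁ ≅
    -- X₃`.
    let m : S.X₁ →ₗ[R] s.P := s.i.hom ∘ₗ S.f.hom
    refine ⟨_, .inl ?_, exists_projSequence m (hi.comp hf)⟩
    let u' : S.X₂ →ₗ[R] s.P ⧸ LinearMap.range m := (LinearMap.range m).mkQ ∘ₗ s.i.hom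
    have hu' (y : S.X₂) : u' y = 0 ↔ S.g y = 0 := by
      change (LinearMap.range m).mkQ (s.i y) = 0 ↔ _
      rw [← LinearMap.mem_ker, Submodule.ker_mkQ]
      constructor
      · rintro ⟨x, hx⟩
        rw [← hi hx]
        exact shortExact_apply_apply x
      · intro hy
        obtain ⟨x, rfl⟩ := hex y hy
        exact ⟨x, rfl⟩
    let e : (S.X₂ ⧸ LinearMap.ker S.g.hom) ≃ₗ[R] S.X₃ :=
      LinearMap.quotKerEquivOfSurjective S.g.hom hg
    let u : (S.X₂ ⧸ LinearMap.ker S.g.hom) →ₗ[R] s.P ⧸ LinearMap.range m :=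
      (LinearMap.ker S.g.hom).liftQ u' (fun p hp => (hu' p).2 hp)
    let v : s.P ⧸ LinearMap.range m →ₗ[R] G :=
      (LinearMap.range m).liftQ s.q.hom (by
        rintro _ ⟨y, rfl⟩
        exact hz _)
    obtain ⟨w, hw⟩ := shortExact_ofHom u v
      (by
        rw [injective_iff_map_eq_zero]
        intro x hx
        obtain ⟨p, rfl⟩ := Submodule.mkQ_surjective _ x
        exact (Submodule.Quotient.mk_eq_zero _).2 ((hu' p).1 hx))
      (by
        intro g
        obtain ⟨p, rfl⟩ := hq g
        exact ⟨(LinearMap.range m).mkQ p, rfl⟩)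
      (by
        intro x
        obtain ⟨p, rfl⟩ := Submodule.mkQ_surjective _ x
        exact hz _)
      (by
        intro x hx
        obtain ⟨p, rfl⟩ := Submodule.mkQ_surjective _ x
        obtain ⟨y, rfl⟩ := hex' p hx
        exact ⟨Submodule.Quotient.mk y, rfl⟩)
    have := dingProjective_of_projective S.X₃
    exact DingProjective.of_extension hw (this.of_iso (LinearEquiv.toModuleIso e.symm)) hG

/-- Ding projective modules are closed under kernels of epimorphisms. -/
theorem DingProjective.of_shortExact {S : ShortComplex (ModuleCat.{u} R)}
    (hS : S.ShortExact) (h₂ : DingProjective S.X₂) (h₃ : DingProjective S.X₃) :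
    DingProjective S.X₁ := by
  obtain ⟨G, hG, ⟨s⟩⟩ := h₃.exists_syzygy
  have := s.projective
  have hi : Function.Injective s.i := s.shortExact.moduleCat_injective_f
  have hq : Function.Surjective s.q := s.shortExact.moduleCat_surjective_g
  have hf : Function.Injective S.f := hS.moduleCat_injective_f
  have hg : Function.Surjective S.g := hS.moduleCat_surjective_g
  have hex := (ShortComplex.moduleCat_exact_iff _).1 hS.exact
  have hex' : ∀ x, s.q x = 0 → ∃ y, s.i y = x :=
    (ShortComplex.moduleCat_exact_iff _).1 s.shortExact.exact
  have hz : ∀ x, s.q (s.i x) = 0 := fun x => ConcreteCategory.congr_hom s.w x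
  -- The pullback of `S.X₂ → S.X₃ ← s.P`. It is an extension of `S.X₂` by `G`, hence Ding
  -- projective, and `S.X₁` is the kernel of its projection onto the projective `s.P`.
  let E : Submodule R (S.X₂ × s.P) :=
    LinearMap.ker (S.g.hom ∘ₗ LinearMap.fst R _ _ - s.q.hom ∘ₗ LinearMap.snd R _ _)
  have hE (x : S.X₂ × s.P) : x ∈ E ↔ S.g x.1 = s.q x.2 := by
    rw [LinearMap.mem_ker, LinearMap.sub_apply, sub_eq_zero]
    rfl
  have hz' (x : S.X₁) : S.g (S.f x) = 0 := shortExact_apply_apply x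
  obtain ⟨w, hw⟩ := shortExact_ofHom
    ((LinearMap.inr R S.X₂ s.P ∘ₗ s.i.hom).codRestrict E (fun x => by
      rw [hE]
      change S.g 0 = s.q (s.i x)
      rw [hz, map_zero]))
    (LinearMap.fst R _ _ ∘ₗ E.subtype)
    (fun x y hxy => hi (congr_arg (fun z => z.1.2) hxy))
    (fun y => by
      obtain ⟨p, hp⟩ := hq (S.g y)
      exact ⟨⟨(y, p), (hE _).2 hp.symm⟩, rfl⟩)
    (fun _ => rfl)
    (by
      rintro ⟨⟨y, p⟩, h⟩ h'
      obtain rfl : y = 0 := h'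
      rw [hE] at h
      obtain ⟨x, rfl⟩ := hex' p (by rw [← h, map_zero])
      exact ⟨x, rfl⟩)
  have hE' : DingProjective (ModuleCat.of R E) := DingProjective.of_extension hw hG h₂
  obtain ⟨w', hw'⟩ := shortExact_ofHom
    ((LinearMap.inl R S.X₂ s.P ∘ₗ S.f.hom).codRestrict E (fun x => by
      rw [hE]
      change S.g (S.f x) = s.q 0
      rw [hz', map_zero]))
    (LinearMap.snd R _ _ ∘ₗ E.subtype)
    (fun x y hxy => hf (congr_arg (fun z => z.1.1) hxy))
    (fun p => by
      obtain ⟨y, hy⟩ := hg (s.q p)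
      exact ⟨⟨(y, p), (hE _).2 hy⟩, rfl⟩)
    (fun _ => rfl)
    (by
      rintro ⟨⟨y, p⟩, h⟩ h'
      obtain rfl : p = 0 := h'
      rw [hE] at h
      obtain ⟨x, rfl⟩ := hex y (by rw [h, map_zero])
      exact ⟨x, rfl⟩)
  have : Projective (ShortComplex.mk _ _ w').X₃ := s.projective
  have h := DingProjective.of_shortExact_of_projective hw' hE'
  exact h

end Closure

/-! ### Partial contractions and improvement of complete resolutions -/

section Contractions

variable {V : Type*} [Category V] [Abelian V]

/-- A partial contraction of a complex, in the cohomological degrees below `a`. -/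
def ContractedBelow (C : CochainComplex V ℤ) (a : ℤ) : Prop :=
  ∃ h : Cochain C C (-1), ∀ p < a, (δ (-1) 0 h).v p p (add_zero p) = 𝟙 _

lemma δ_neg_one_v {C : CochainComplex V ℤ} (h : Cochain C C (-1)) (p q r : ℤ) (hq : q + 1 = p)
    (hr : p + 1 = r) : (δ (-1) 0 h).v p p (add_zero p) =
      h.v p q (by omega) ≫ C.d q p + C.d p r ≫ h.v r p (by omega) := by
  rw [δ_v (-1) 0 (by omega) h p p (add_zero p) q r (by omega) hr]
  simp

/-- The contraction in degree `a - 1` shows that `1 - d h` on `C^a` kills the boundaries; writing it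
as `ψ d` supplies the next component of the homotopy. -/
lemma ContractedBelow.succ {C : CochainComplex V ℤ} {a : ℤ} (hC : ContractedBelow C a)
    (hφ : ∀ φ : C.X a ⟶ C.X a, C.d (a - 1) a ≫ φ = 0 →
      ∃ ψ : C.X (a + 1) ⟶ C.X a, C.d a (a + 1) ≫ ψ = φ) : ContractedBelow C (a + 1) := by
  obtain ⟨h, hh⟩ := hC
  have h₁ := hh (a - 1) (by omega)
  rw [δ_neg_one_v h (a - 1) (a - 2) a (by omega) (by omega)] at h₁
  obtain ⟨ψ, hψ⟩ := hφ (𝟙 _ - h.v a (a - 1) (by omega) ≫ C.d (a - 1) a) (by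
    have h₂ := h₁ =≫ C.d (a - 1) a
    simp only [Preadditive.add_comp, Category.assoc, C.d_comp_d, comp_zero, zero_add,
      Category.id_comp] at h₂
    rw [Preadditive.comp_sub, Category.comp_id, h₂, sub_self])
  -- Only the component from degree `a + 1` to `a` changes, becoming `ψ`, so nothing is altered in
  -- degrees below `a`.
  refine ⟨h + Cochain.single (ψ - h.v (a + 1) a (by omega)) (-1), fun p hp => ?_⟩
  rw [δ_neg_one_v _ p (p - 1) (p + 1) (by omega) rfl]
  by_cases hpa : p = a
  · subst hpa
    rw [Cochain.add_v, Cochain.add_v, Cochain.single_v,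
      Cochain.single_v_eq_zero _ _ _ _ _ (by omega), add_zero, add_sub_cancel, hψ, add_sub_cancel]
  · rw [Cochain.add_v, Cochain.add_v, Cochain.single_v_eq_zero _ _ _ _ _ (by omega),
      Cochain.single_v_eq_zero _ _ _ _ _ (by omega), add_zero, add_zero,
      ← δ_neg_one_v h p (p - 1) (p + 1) (by omega) rfl]
    exact hh p (by omega)

lemma ContractedBelow.of_le {C : CochainComplex V ℤ} {a b : ℤ} (hC : ContractedBelow C a)
    (hab : a ≤ b) (hφ : ∀ p, a ≤ p → p < b → ∀ φ : C.X p ⟶ C.X p, C.d (p - 1) p ≫ φ = 0 →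
      ∃ ψ : C.X (p + 1) ⟶ C.X p, C.d p (p + 1) ≫ ψ = φ) : ContractedBelow C b := by
  induction b, hab using Int.leInduction with
  | base => exact hC
  | succ b hab ih =>
    exact (ih fun p hp hp' => hφ p hp (by omega)).succ (hφ b hab (by omega))

/-- A complex contracted below degree `a` is homotopy equivalent to a direct summand which
vanishes below degree `a`. -/
lemma ContractedBelow.exists_retract {C : CochainComplex V ℤ} {a : ℤ}
    (hC : ContractedBelow C a) :
    ∃ (C' : CochainComplex V ℤ) (i : C' ⟶ C) (r : C ⟶ C'), i ≫ r = 𝟙 C' ∧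
      Nonempty (Homotopy (r ≫ i) (𝟙 C)) ∧ ∀ p < a, IsZero (C'.X p) := by
  obtain ⟨h, hh⟩ := hC
  -- Cutting `h` off above `a` makes `e = 1 - (d h₀ + h₀ d)` zero below `a` and the identity above
  -- `a`. In degree `a` it is idempotent because `e` commutes with `d` and vanishes in degree `a -
  -- 1`.
  let h₀ : Cochain C C (-1) := Cochain.mk fun p q hpq => if p ≤ a then h.v p q hpq else 0
  have h₀_le (p q : ℤ) (hpq : p + (-1) = q) (hp : p ≤ a) : h₀.v p q hpq = h.v p q hpq := by
    simp [h₀, hp]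
  have h₀_gt (p q : ℤ) (hpq : p + (-1) = q) (hp : a < p) : h₀.v p q hpq = 0 := by
    simp [h₀, hp]
  let n : C ⟶ C := Homotopy.nullHomotopicMap' fun i j hij => h₀.v i j (by
    change j + 1 = i at hij; omega)
  have hn (p : ℤ) : n.f p = (δ (-1) 0 h₀).v p p (add_zero p) := by
    rw [δ_neg_one_cochain, Cochain.ofHom_v]
  let e : C ⟶ C := 𝟙 C - n
  have he_lt (p : ℤ) (hp : p < a) : e.f p = 0 := by
    change 𝟙 _ - n.f p = 0
    rw [hn, δ_neg_one_v _ p (p - 1) (p + 1) (by omega) rfl, h₀_le _ _ _ (by omega),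
      h₀_le _ _ _ (by omega), ← δ_neg_one_v h p (p - 1) (p + 1) (by omega) rfl, hh p hp, sub_self]
  have he_ge (p : ℤ) (hp : a ≤ p) :
      e.f p = 𝟙 _ - h₀.v p (p - 1) (by omega) ≫ C.d (p - 1) p := by
    change 𝟙 _ - n.f p = _
    rw [hn, δ_neg_one_v _ p (p - 1) (p + 1) (by omega) rfl, h₀_gt (p + 1) _ _ (by omega),
      comp_zero, add_zero]
  have he : e ≫ e = e := by
    ext p
    rw [HomologicalComplex.comp_f]
    rcases lt_trichotomy p a with hp | rfl | hp
    · rw [he_lt p hp, comp_zero]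
    · conv_lhs => enter [1]; rw [he_ge p le_rfl]
      rw [Preadditive.sub_comp, Category.id_comp, Category.assoc, ← e.comm, he_lt (p - 1) (by omega),
        zero_comp, comp_zero, sub_zero]
    · rw [he_ge p hp.le, h₀_gt _ _ _ hp, zero_comp, sub_zero, Category.comp_id]
  obtain ⟨C', i, r, hir, hri⟩ := IsIdempotentComplete.idempotents_split C e he
  refine ⟨C', i, r, hir, ⟨?_⟩, fun p hp => ?_⟩
  · have H : Homotopy n 0 := Homotopy.nullHomotopy' _
    rw [hri]
    exact (Homotopy.equivSubZero.symm ((Homotopy.ofEq (by simp [e])).trans H)).symm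
  · rw [IsZero.iff_id_eq_zero]
    have h₁ : i.f p ≫ r.f p = 𝟙 _ := by rw [← HomologicalComplex.comp_f, hir]; rfl
    have h₂ : r.f p ≫ i.f p = 0 := by rw [← HomologicalComplex.comp_f, hri, he_lt p hp]
    calc 𝟙 (C'.X p) = (i.f p ≫ r.f p) ≫ i.f p ≫ r.f p := by rw [h₁, Category.comp_id]
      _ = 0 := by rw [Category.assoc, reassoc_of% h₂, zero_comp, comp_zero]

/-- The cone of a morphism that is bijective in degrees `≤ c` is contracted below degree `c`. -/
lemma contractedBelow_mappingCone {T P : CochainComplex V ℤ} (τ : T ⟶ P) (c : ℤ)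
    (hτ : ∀ p ≤ c, IsIso (τ.f p)) : ContractedBelow (mappingCone τ) c := by
  -- The value above `c` is immaterial: contracting in a degree `p < c` involves `σ` only in degrees
  -- `p` and `p + 1`.
  let σ : Cochain P T 0 := Cochain.ofHoms fun p =>
    if hp : p ≤ c then (have := hτ p hp; inv (τ.f p)) else 0
  have hσ (p : ℤ) (hp : p ≤ c) : τ.f p ≫ σ.v p p (add_zero p) = 𝟙 _ := by
    have := hτ p hp
    simp [σ, hp]
  have hσ' (p : ℤ) (hp : p ≤ c) : σ.v p p (add_zero p) ≫ τ.f p = 𝟙 _ := by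
    have := hτ p hp
    simp [σ, hp]
  let h : Cochain (mappingCone τ) (mappingCone τ) (-1) :=
    ((mappingCone.snd τ).comp σ (add_zero 0)).comp (mappingCone.inl τ) (zero_add (-1))
  refine ⟨h, fun p hp => ?_⟩
  have hv (p q : ℤ) (hpq : p + (-1) = q) : h.v p q hpq =
      (mappingCone.snd τ).v p p (add_zero p) ≫ σ.v p p (add_zero p) ≫
        (mappingCone.inl τ).v p q hpq := by
    simp [h]
  have hd : T.d p (p + 1) ≫ (mappingCone.inl τ).v (p + 1) p (by omega) =
      τ.f p ≫ (mappingCone.inr τ).f p -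
        (mappingCone.inl τ).v p (p - 1) (by omega) ≫ (mappingCone τ).d (p - 1) p := by
    rw [mappingCone.inl_v_d τ p (p - 1) (p + 1) (by omega) (by omega)]
    abel
  have hcomm : P.d p (p + 1) ≫ σ.v (p + 1) (p + 1) (add_zero _) =
      σ.v p p (add_zero p) ≫ T.d p (p + 1) := by
    have := hτ p hp.le
    rw [← cancel_epi (τ.f p), reassoc_of% hσ p hp.le, τ.comm_assoc, hσ (p + 1) (by omega),
      Category.comp_id]
  rw [δ_neg_one_v h p (p - 1) (p + 1) (by omega) rfl, hv, hv, Category.assoc, Category.assoc,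
    mappingCone.ext_from_iff τ (p + 1) p rfl]
  constructor
  · rw [Preadditive.comp_add, mappingCone.inl_v_snd_v_assoc, zero_comp, zero_add,
      mappingCone.inl_v_d_assoc τ (p + 1) p (p + 2) (by omega) (by omega), Preadditive.sub_comp,
      Category.assoc, mappingCone.inr_f_snd_v_assoc, reassoc_of% hσ (p + 1) (by omega),
      Category.assoc, mappingCone.inl_v_snd_v_assoc, zero_comp, comp_zero, sub_zero,
      Category.comp_id]
  · rw [Preadditive.comp_add, mappingCone.inr_f_snd_v_assoc, mappingCone.inr_f_d_assoc,
      mappingCone.inr_f_snd_v_assoc, reassoc_of% hcomm, hd, Preadditive.comp_sub,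
      reassoc_of% hσ' p hp.le, add_sub_cancel, Category.comp_id]

variable {R : Type u} [Ring R]

/-- This is the long exact sequence of the cone under `Hom(-, F)`: solve on `P` first, then correct
the discrepancy on `T`. -/
lemma homExactAt_mappingCone {T P : Cplx R} (τ : T ⟶ P) {F : ModuleCat.{u} R} {p : ℤ}
    (hP : HomExactAt P F p) (hT : HomExactAt T F (p + 1)) :
    HomExactAt (mappingCone τ) F p := by
  intro φ hφ
  obtain ⟨ψ, hψ⟩ := hP ((mappingCone.inr τ).f p ≫ φ) (by
    rw [← mappingCone.inr_f_d_assoc, hφ, comp_zero])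
  obtain ⟨χ, hχ⟩ := hT.exists_eq (p' := p) rfl rfl
    (τ.f (p + 1) ≫ ψ - (mappingCone.inl τ).v (p + 1) p (by omega) ≫ φ) (by
      have h := mappingCone.inl_v_d_assoc τ p (p - 1) (p + 1) (by omega) (by omega) φ
      rw [hφ, comp_zero, Preadditive.sub_comp, Category.assoc, Category.assoc] at h
      rw [Preadditive.comp_sub, ← τ.comm_assoc, hψ, ← h])
  refine ⟨(mappingCone.snd τ).v (p + 1) (p + 1) (add_zero _) ≫ ψ +
    (mappingCone.fst τ).1.v (p + 1) (p + 1 + 1) rfl ≫ χ, ?_⟩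
  rw [mappingCone.ext_from_iff τ (p + 1) p rfl]
  constructor
  · rw [mappingCone.inl_v_d_assoc τ (p + 1) p (p + 1 + 1) (by omega) (by omega), Preadditive.sub_comp,
      Preadditive.comp_add, Category.assoc, Category.assoc, mappingCone.inr_f_snd_v_assoc,
      mappingCone.inr_f_fst_v_assoc, zero_comp, comp_zero, add_zero, Preadditive.comp_add,
      Category.assoc, Category.assoc, mappingCone.inl_v_snd_v_assoc, zero_comp, comp_zero,
      zero_add, mappingCone.inl_v_fst_v_assoc, hχ]
    abel
  · rw [mappingCone.inr_f_d_assoc, Preadditive.comp_add, mappingCone.inr_f_snd_v_assoc,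
      mappingCone.inr_f_fst_v_assoc, zero_comp, add_zero, hψ]

lemma projective_mappingCone_X {T P : Cplx R} (τ : T ⟶ P) (hT : ∀ p, Projective (T.X p))
    (hP : ∀ p, Projective (P.X p)) (p : ℤ) : Projective ((mappingCone τ).X p) := by
  have := hT (p + 1)
  have := hP p
  exact (Retract.mk (Y := T.X (p + 1) ⊞ P.X p)
    (biprod.lift ((mappingCone.fst τ).1.v p (p + 1) rfl)
      ((mappingCone.snd τ).v p p (add_zero p)))
    (biprod.desc ((mappingCone.inl τ).v (p + 1) p (by omega)) ((mappingCone.inr τ).f p))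
    (by rw [biprod.lift_desc]; exact mappingCone.id_X τ p (p + 1) rfl)).projective

lemma projective_mappingCocone_X {P C : Cplx R} (φ : P ⟶ C) (hP : ∀ p, Projective (P.X p))
    (hC : ∀ p, Projective (C.X p)) (p : ℤ) : Projective ((mappingCocone φ).X p) :=
  projective_mappingCone_X φ hP hC (p + -1)

/-- Total `ℱ`-acyclicity of complexes of projectives is invariant under homotopy equivalence. -/
lemma TotallyFAcyclic.of_homotopyCategory_iso {T T' : Cplx R} (hT : TotallyFAcyclic T)
    (hT' : ∀ p, Projective (T'.X p))
    (e : (HomotopyCategory.quotient _ _).obj T ≅ (HomotopyCategory.quotient _ _).obj T') :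
    TotallyFAcyclic T' where
  projective l := hT' _
  acyclic := by
    rw [← HomotopyCategory.quotient_obj_mem_subcategoryAcyclic_iff_acyclic]
    exact ObjectProperty.prop_of_iso _ e
      ((HomotopyCategory.quotient_obj_mem_subcategoryAcyclic_iff_acyclic T).2 hT.acyclic)
  hom_acyclic F hF m := by
    have h := (HomologicalComplex.exactAt_iff_isZero_homology _ _).1 (hT.hom_acyclic F hF m)
    rw [HomologicalComplex.exactAt_iff_isZero_homology]
    rw [isZero_homCplx_homology_iff_homotopyCategory] at h ⊢
    intro f
    have := h (e.hom ≫ f)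
    rwa [Preadditive.IsIso.comp_left_eq_zero] at this

-- The rotated cone triangle exhibits `T[1]` as the cone of `P → Cone τ`. Replacing `Cone τ` by the
-- homotopy equivalent `C` and shifting back gives the cocone.
open Pretriangulated in
lemma nonempty_mappingCocone_iso {T P C : Cplx R} (τ : T ⟶ P) (r : mappingCone τ ⟶ C)
    (hr : IsIso ((HomotopyCategory.quotient _ (ComplexShape.up ℤ)).map r)) :
    Nonempty ((HomotopyCategory.quotient _ (ComplexShape.up ℤ)).obj T ≅
      (HomotopyCategory.quotient _ (ComplexShape.up ℤ)).obj
        (mappingCocone (mappingCone.inr τ ≫ r))) := by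
  let q := HomotopyCategory.quotient (ModuleCat.{u} R) (ComplexShape.up ℤ)
  let φ := mappingCone.inr τ ≫ r
  let eC : q.obj (mappingCone τ) ≅ q.obj C := @asIso _ _ _ _ (q.map r) hr
  obtain ⟨e, -⟩ := exists_iso_of_arrow_iso (mappingCone.triangleh τ).rotate
    (mappingCone.triangleh φ)
    (rot_of_distTriang _ (HomotopyCategory.mappingCone_triangleh_distinguished τ))
    (HomotopyCategory.mappingCone_triangleh_distinguished φ)
    (Arrow.isoMk (Iso.refl _) eC ((Category.id_comp _).trans (q.map_comp (mappingCone.inr τ) r)))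
  let e₃ : (q.obj T)⟦(1 : ℤ)⟧ ≅ q.obj (mappingCone φ) := Triangle.π₃.mapIso e
  exact ⟨(shiftEquiv _ (1 : ℤ)).unitIso.app (q.obj T) ≪≫
    (CategoryTheory.shiftFunctor _ (-1 : ℤ)).mapIso e₃ ≪≫
    ((q.commShiftIso (-1 : ℤ)).app (mappingCone φ)).symm⟩

/-- If `H^q(Hom_R(P, F)) = 0` for all `q > n` and all flat modules `F`, a complete resolution
`T → P` can be replaced with one that is bijective in all degrees `≥ n`. -/
theorem exists_totallyFAcyclic_of_homExactAt {T P : Cplx R} (hT : TotallyFAcyclic T)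
    (hP : ∀ p, Projective (P.X p)) (τ : T ⟶ P) (c : ℤ) (hτ : ∀ p ≤ c, IsIso (τ.f p)) (a : ℤ)
    (h : ∀ F : ModuleCat.{u} R, IsFlat R F → ∀ p < a, HomExactAt P F p) :
    ∃ (T' : Cplx R) (τ' : T' ⟶ P), TotallyFAcyclic T' ∧ ∀ p ≤ a, IsIso (τ'.f p) := by
  let C := mappingCone τ
  have hC (p : ℤ) : Projective (C.X p) := projective_mappingCone_X τ hT.projective_X hP p
  -- The coefficient in degree `p` is `C^p` itself, flat because projective. Starting at `min a c`
  -- covers the case `a < c`.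
  have hcontr : ContractedBelow C a :=
    ((contractedBelow_mappingCone τ (min a c) fun p hp => hτ p (by omega)).of_le (by omega)
      fun p _ hp => homExactAt_mappingCone τ (h _ (isFlat_of_projective _) p hp)
        (hT.homExactAt (isFlat_of_projective _) _))
  obtain ⟨C', i, r, hir, ⟨H⟩, hC'⟩ := hcontr.exists_retract
  have hC'' (p : ℤ) : Projective (C'.X p) :=
    (Retract.mk (i.f p) (r.f p) (by rw [← HomologicalComplex.comp_f, hir]; rfl)).projective
  let q := HomotopyCategory.quotient (ModuleCat.{u} R) (ComplexShape.up ℤ)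
  have hr : IsIso (q.map r) := ⟨q.map i, by
    rw [← q.map_comp, HomotopyCategory.eq_of_homotopy _ _ H, q.map_id], by
    rw [← q.map_comp, hir, q.map_id]⟩
  obtain ⟨e⟩ := nonempty_mappingCocone_iso τ r hr
  refine ⟨mappingCocone (mappingCone.inr τ ≫ r), mappingCocone.fst _,
    hT.of_homotopyCategory_iso (projective_mappingCocone_X _ hP hC'') e, fun p hp => ?_⟩
  -- In degree `p` the cocone is `P^p ⊕ C'^(p-1)`, whose second summand vanishes for `p ≤ a`.
  refine ⟨(mappingCocone.inl _).v p p (add_zero p), ?_, mappingCocone.inl_v_fst_f _ p⟩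
  have := mappingCocone.id_X (mappingCone.inr τ ≫ r) p (p - 1) (by omega)
  rwa [(hC' (p - 1) (by omega)).eq_of_tgt ((mappingCocone.snd _).v p (p - 1) _) 0, zero_comp,
    add_zero] at this

end Contractions

/-! ### RHom into complexes of finite flat dimension -/

section FlatDimension

variable {R : Type u} [Ring R]

lemma isIso_of_bijective_neg {T P : Cplx R} (τ : T ⟶ P) (n : ℤ)
    (h : ∀ i ≥ n, Function.Bijective (τ.f (-i))) (p : ℤ) (hp : p ≤ -n) : IsIso (τ.f p) := by
  rw [ConcreteCategory.isIso_iff_bijective]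
  have := h (-p) (by lia)
  rwa [neg_neg] at this

lemma bijective_neg_of_isIso {T P : Cplx R} (τ : T ⟶ P) (n : ℤ)
    (h : ∀ p ≤ -n, IsIso (τ.f p)) (i : ℤ) (hi : i ≥ n) : Function.Bijective (τ.f (-i)) := by
  have := h (-i) (by lia)
  exact ConcreteCategory.bijective_of_isIso _

lemma HomExactAt.of_iso {K : Cplx R} {F F' : ModuleCat.{u} R} {p : ℤ} (h : HomExactAt K F p)
    (e : F ≅ F') : HomExactAt K F' p := by
  intro φ hφ
  obtain ⟨ψ, hψ⟩ := h (φ ≫ e.inv) (by rw [reassoc_of% hφ, zero_comp])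
  exact ⟨ψ ≫ e.hom, by rw [reassoc_of% hψ, e.inv_hom_id, Category.comp_id]⟩

lemma homExactAt_of_isZero (K : Cplx R) {F : ModuleCat.{u} R} (hF : IsZero F) (p : ℤ) :
    HomExactAt K F p :=
  fun _ _ => ⟨0, hF.eq_of_tgt _ _⟩

/-- The coefficients `F` for which `Hom_R(T, F)` is exact are closed under kernels of
epimorphisms. -/
lemma homExactAt_left {T : Cplx R} (hT : ∀ p, Projective (T.X p))
    {S : ShortComplex (ModuleCat.{u} R)} (hS : S.ShortExact) (h₂ : ∀ p, HomExactAt T S.X₂ p)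
    (h₃ : ∀ p, HomExactAt T S.X₃ p) (p : ℤ) : HomExactAt T S.X₁ p := by
  have := hS.mono_f
  have := hS.epi_g
  intro φ hφ
  obtain ⟨ψ, hψ⟩ := h₂ p (φ ≫ S.f) (by rw [reassoc_of% hφ, zero_comp])
  obtain ⟨χ, hχ⟩ := (h₃ (p + 1)).exists_eq (p' := p) rfl rfl (ψ ≫ S.g) (by
    rw [reassoc_of% hψ, S.zero, comp_zero])
  have := hT (p + 1 + 1)
  let χ' := Projective.factorThru χ S.g
  have hχ' : χ' ≫ S.g = χ := Projective.factorThru_comp _ _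
  have h₀ : (ψ - T.d (p + 1) (p + 1 + 1) ≫ χ') ≫ S.g = 0 := by
    rw [Preadditive.sub_comp, Category.assoc, hχ', hχ, sub_self]
  refine ⟨hS.exact.lift _ h₀, ?_⟩
  rw [← cancel_mono S.f, Category.assoc, hS.exact.lift_f, Preadditive.comp_sub,
    T.d_comp_d_assoc, zero_comp, sub_zero, hψ]

lemma homExactAt_of_isIso {T P : Cplx R} (τ : T ⟶ P) (c : ℤ) (hτ : ∀ p ≤ c, IsIso (τ.f p))
    {F : ModuleCat.{u} R} (h : ∀ p, HomExactAt T F p) (p : ℤ) (hp : p < c) :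
    HomExactAt P F p := by
  intro φ hφ
  obtain ⟨ψ, hψ⟩ := h p (τ.f p ≫ φ) (by rw [← τ.comm_assoc, hφ, comp_zero])
  have := hτ (p + 1) (by lia)
  have := hτ p (by lia)
  refine ⟨inv (τ.f (p + 1)) ≫ ψ, ?_⟩
  rw [← cancel_epi (τ.f p), τ.comm_assoc, IsIso.hom_inv_id_assoc, hψ]

/-- The lowest component of `z`, in target degree `j`, is a cocycle on its own and hence can be
removed by a coboundary, raising `j`. `N` bounds the number of target degrees that remain. -/
lemma mem_coboundaries_aux {P F : Cplx R} (m b : ℤ) (hb : ∀ k > b, IsZero (F.X k))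
    (h : ∀ p k, p + m = k → HomExactAt P (F.X k) p) (N : ℕ) :
    ∀ (j : ℤ) (_ : b < j + N) (z : Cocycle P F m),
      (∀ p q hpq, q < j → z.1.v p q hpq = 0) → z ∈ coboundaries P F m := by
  induction N with
  | zero =>
    intro j hj z hz
    have : z = 0 := by
      refine Cocycle.ext (Cochain.ext _ _ fun p q hpq => ?_)
      rw [Cocycle.coe_zero, Cochain.zero_v]
      by_cases hq : q < j
      · exact hz p q hpq hq
      · exact (hb q (by push_cast at hj; lia)).eq_of_tgt _ _
    rw [this]
    exact zero_mem _
  | succ N ih =>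
    intro j hj z hz
    obtain ⟨p, hp⟩ : ∃ p, p + m = j := ⟨j - m, by lia⟩
    have hd := Cochain.congr_v (z.δ_eq_zero (m + 1)) (p - 1) j (by lia)
    rw [δ_v m (m + 1) rfl z.1 (p - 1) j (by lia) (j - 1) p rfl (by lia), Cochain.zero_v,
      hz _ _ _ (by lia), zero_comp, zero_add] at hd
    have hd' : P.d (p - 1) p ≫ z.1.v p j hp = 0 := by
      rwa [smul_eq_zero_iff_eq] at hd
    obtain ⟨ψ, hψ⟩ := h p j hp (z.1.v p j hp) hd'
    -- The sign cancels the one in `δ`, so `δ β` has component `d ψ` in target degree `j`; its other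
    -- component lies in degree `j + 1`.
    let β : Cochain P F (m - 1) := m.negOnePow • Cochain.single ψ (m - 1)
    have hβ : δ (m - 1) m β = m.negOnePow • Cochain.single (ψ ≫ F.d j (j + 1)) m +
        Cochain.single (P.d p (p + 1) ≫ ψ) m := by
      rw [δ_units_smul, Cochain.δ_single ψ (m - 1) m (by lia) p (j + 1) rfl rfl, smul_add,
        smul_smul, Int.units_mul_self, one_smul]
    let w : Cocycle P F m := Cocycle.mk (δ (m - 1) m β) (m + 1) rfl (δ_δ _ _ _ _)
    have hw : w ∈ coboundaries P F m :=
      (mem_coboundaries_iff w (m - 1) (by lia)).2 ⟨β, rfl⟩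
    have hzw : z - w ∈ coboundaries P F m := by
      refine ih (j + 1) (by push_cast at hj; lia) _ fun p' q' hpq' hq' => ?_
      change (z.1 - δ (m - 1) m β).v p' q' hpq' = 0
      rw [hβ, Cochain.sub_v, Cochain.add_v, Cochain.units_smul_v,
        Cochain.single_v_eq_zero' _ _ _ _ _ (by lia), smul_zero, zero_add]
      by_cases hq : q' = j
      · subst hq
        obtain rfl : p' = p := by lia
        rw [Cochain.single_v, hψ, sub_self]
      · rw [Cochain.single_v_eq_zero' _ _ _ _ _ hq, sub_zero]
        exact hz _ _ _ (by lia)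
    simpa using add_mem hzw hw

/-- A cocycle with values in a bounded complex is a coboundary if it is one componentwise. -/
lemma mem_coboundaries_of_homExactAt {P F : Cplx R} (m a b : ℤ) (ha : ∀ k < a, IsZero (F.X k))
    (hb : ∀ k > b, IsZero (F.X k)) (h : ∀ p k, p + m = k → HomExactAt P (F.X k) p)
    (z : Cocycle P F m) : z ∈ coboundaries P F m :=
  mem_coboundaries_aux m b hb h (b + 1 - a).toNat a (by lia) z
    fun _ q _ hq => (ha q hq).eq_of_tgt _ _

section Cycles

variable {V : Type*} [Category V] [Abelian V]

/-- The sequence `0 → Z_l(K) → K_l → Z_{l-1}(K) → 0`. -/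
abbrev cyclesSequence (K : CochainComplex V ℤ) (p q : ℤ) : ShortComplex V :=
  ShortComplex.mk (K.iCycles p) (K.toCycles p q) (by
    rw [← cancel_mono (K.iCycles q), Category.assoc, K.toCycles_i, zero_comp, K.iCycles_d])

lemma cyclesSequence_shortExact (K : CochainComplex V ℤ) (p q : ℤ) (hpq : p + 1 = q)
    (hK : K.ExactAt q) : (cyclesSequence K p q).ShortExact := by
  have h₁ : Epi (K.toCycles p q) := by
    obtain rfl : p = (ComplexShape.up ℤ).prev q := by simp [← hpq]
    have h := (ShortComplex.exact_iff_epi_toCycles _).1 hK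
    have : (K.sc q).toCycles = K.toCycles _ q :=
      (cancel_mono (K.sc q).iCycles).1
        ((K.sc q).toCycles_i.trans (K.toCycles_i _ q).symm)
    rwa [this] at h
  refine ShortComplex.ShortExact.mk' ?_ inferInstance h₁
  let S := ShortComplex.mk (K.iCycles p) (K.d p q) (K.iCycles_d _ _)
  have hS : S.Exact := S.exact_of_f_is_kernel (K.cyclesIsKernel p q (by simp [← hpq]))
  let φ : cyclesSequence K p q ⟶ S :=
    { τ₁ := 𝟙 _
      τ₂ := 𝟙 _
      τ₃ := K.iCycles q
      comm₂₃ := by simp [S] }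
  have : Epi φ.τ₁ := inferInstanceAs (Epi (𝟙 _))
  have : IsIso φ.τ₂ := inferInstanceAs (IsIso (𝟙 _))
  have : Mono φ.τ₃ := inferInstanceAs (Mono (K.iCycles q))
  exact (ShortComplex.exact_iff_of_epi_of_isIso_of_mono φ).2 hS

lemma Equivalent.exactAt {X Y : CochainComplex V ℤ} (h : Equivalent X Y) (p : ℤ)
    (hY : Y.ExactAt p) : X.ExactAt p := by
  obtain ⟨Z, f, g, hf, hg⟩ := h
  have := (quasiIsoAt_iff_exactAt' g p hY).1 inferInstance
  exact (quasiIsoAt_iff_exactAt f p this).1 inferInstance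

lemma Equivalent.refl (X : CochainComplex V ℤ) : Equivalent X X :=
  ⟨X, 𝟙 X, 𝟙 X, inferInstance, inferInstance⟩

lemma equivalent_of_quasiIso {X Y : CochainComplex V ℤ} (f : X ⟶ Y) [QuasiIso f] :
    Equivalent X Y :=
  ⟨X, 𝟙 X, f, inferInstance, inferInstance⟩

lemma exactAt_of_isZero_hl {X : CochainComplex V ℤ} {l p : ℤ} (h : IsZero (hl X l))
    (hp : p = -l) : X.ExactAt p := by
  subst hp
  exact (HomologicalComplex.exactAt_iff_isZero_homology _ _).2 h

end Cycles

lemma exists_int_of_lt_top {x : EReal} (hx : x < ⊤) : ∃ n : ℤ, x < toE n := by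
  obtain ⟨r, hr, -⟩ := EReal.lt_iff_exists_real_btwn.1 hx
  obtain ⟨n, hn⟩ := exists_int_gt r
  exact ⟨n, hr.trans (EReal.coe_lt_coe_iff.2 hn)⟩

lemma toE_le_toE {m n : ℤ} : toE m ≤ toE n ↔ m ≤ n := by
  simp [toE]

lemma toE_lt_toE {m n : ℤ} : toE m < toE n ↔ m < n := by
  simp [toE]

lemma exists_bounded_of_flatDim_lt_top {U : Cplx R} (hU : flatDim U < ⊤) :
    ∃ (F : Cplx R) (a b : ℤ), Equivalent F U ∧ (∀ k < a, IsZero (F.X k)) ∧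
      (∀ k > b, IsZero (F.X k)) ∧ ∀ k, IsFlat R (F.X k) := by
  obtain ⟨_, ⟨F, ⟨hFU, ⟨N, hN⟩, hF⟩, rfl⟩, hlt⟩ := sInf_lt_iff.1 hU
  obtain ⟨d, hd⟩ := exists_int_of_lt_top hlt
  refine ⟨F, -d, -N, hFU, fun k hk => ?_, fun k hk => ?_, fun k => ?_⟩
  · by_contra hne
    have h₁ : toE (-k) ≤ supComp F :=
      le_sSup ⟨-k, by change ¬ IsZero (F.X (- -k)); rwa [neg_neg], rfl⟩
    have := toE_lt_toE.1 (h₁.trans_lt hd)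
    lia
  · have := hN (-k) (by lia)
    rwa [comp, neg_neg] at this
  · have := hF (-k)
    rwa [comp, neg_neg] at this

/-- If `X` has an `ℱ`-complete resolution bijective in degrees `≥ n`, then `RHom_R(X, U)` has no
homology below `inf U - n` for complexes `U` of finite flat dimension. -/
theorem isZero_RHom_homology_of_flatDim {X : Cplx R} (κ : FCompleteResolution X) (n : ℤ)
    (hκ : ∀ i ≥ n, Function.Bijective (κ.τ.f (-i))) {U : Cplx R} (hU : flatDim U < ⊤) (s : ℤ)
    (hs : ∀ l < s, IsZero (hl U l)) (ρ : DGProjectiveResolution X) (m : ℤ) (hm : n - s < m) :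
    IsZero ((RHom ρ U).homology m) := by
  obtain ⟨F, a, b, hFU, ha, hb, hF⟩ := exists_bounded_of_flatDim_lt_top hU
  have hFex (k : ℤ) (hk : -s < k) : F.ExactAt k :=
    hFU.exactAt k (exactAt_of_isZero_hl (hs (-k) (by lia)) (by lia))
  have : F.IsLE (-s) := (F.isLE_iff (-s)).2 hFex
  rw [← isZero_RHom_homology_congr κ.res ρ hFU,
    ← isZero_RHom_homology_congr κ.res κ.res (equivalent_of_quasiIso (F.ιTruncLE (-s))),
    isZero_homCplx_homology_iff]
  have hT := κ.totallyFAcyclic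
  have hTF (k p : ℤ) : HomExactAt κ.T (F.X k) p := hT.homExactAt (hF k) p
  -- The cycles need not be flat. Descend from above `b`, where they vanish, along `0 → Z^k → F^k →
  -- Z^(k+1) → 0`, exact since `F` is exact above `-s`.
  have hcyc (N : ℕ) : ∀ k, -s ≤ k → b < k + N → ∀ p, HomExactAt κ.T (F.cycles k) p := by
    induction N with
    | zero =>
      intro k _ hk p
      refine homExactAt_of_isZero _ ?_ p
      exact IsZero.of_mono (F.iCycles k) (hb k (by push_cast at hk; lia))
    | succ N ih =>
      intro k hk hk' p
      exact homExactAt_left hT.projective_X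
        (cyclesSequence_shortExact F k (k + 1) rfl (hFex _ (by lia)))
        (hTF k) (ih (k + 1) (by lia) (by push_cast at hk'; lia)) p
  have htrunc (k p : ℤ) : HomExactAt κ.T ((F.truncLE (-s)).X k) p := by
    rcases lt_trichotomy k (-s) with hk | rfl | hk
    · exact (hTF k p).of_iso (F.truncLEXIso (-s) k hk).symm
    · exact (hcyc (b + s + 1).toNat (-s) le_rfl (by lia) p).of_iso (F.truncLEXIsoCycles (-s)).symm
    · exact homExactAt_of_isZero _ ((F.truncLE (-s)).isZero_of_isStrictlyLE (-s) k hk) p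
  refine mem_coboundaries_of_homExactAt m (min a (-s)) (-s) (fun k hk => ?_)
    (fun k hk => (F.truncLE (-s)).isZero_of_isStrictlyLE (-s) k hk) (fun p k hpk => ?_)
  · exact (ha k (by lia)).of_iso (F.truncLEXIso (-s) k (by lia))
  · by_cases hk : k ≤ -s
    -- From `p + m = k ≤ -s` and `m > n - s` comes `p < -n`, the range in which exactness passes
    -- from `T` to `P`.
    · exact homExactAt_of_isIso κ.τ (-n) (isIso_of_bijective_neg κ.τ n hκ) (htrunc k) p (by lia)
    · exact homExactAt_of_isZero _ ((F.truncLE (-s)).isZero_of_isStrictlyLE (-s) k (by lia)) p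

end FlatDimension

/-! ### Comparison of complexes in a range; projective cokernels and cycles -/

section Transfer

variable {V : Type*} [Category V] [Abelian V]

lemma exactAt_of_isIso {K L : CochainComplex V ℤ} (τ : K ⟶ L) (p : ℤ) (hK : K.ExactAt p)
    (h₀ : IsIso (τ.f (p - 1))) (h₁ : IsIso (τ.f p)) (h₂ : IsIso (τ.f (p + 1))) : L.ExactAt p := by
  rw [HomologicalComplex.exactAt_iff' _ (p - 1) p (p + 1) (by simp) (by simp)] at hK ⊢
  let φ : K.sc' (p - 1) p (p + 1) ⟶ L.sc' (p - 1) p (p + 1) :=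
    (HomologicalComplex.shortComplexFunctor' V _ _ _ _).map τ
  have : IsIso φ.τ₁ := h₀
  have : IsIso φ.τ₂ := h₁
  have : IsIso φ.τ₃ := h₂
  have : IsIso φ := ShortComplex.isIso_of_isIso φ
  exact ShortComplex.exact_of_iso (asIso φ) hK

lemma isIso_opcyclesMap_of_isIso {K L : CochainComplex V ℤ} (τ : K ⟶ L) (p : ℤ)
    (h₀ : IsIso (τ.f (p - 1))) (h₁ : IsIso (τ.f p)) :
    IsIso (HomologicalComplex.opcyclesMap τ p) := by
  obtain ⟨q, hq, hq'⟩ : ∃ q, q = p - 1 ∧ (ComplexShape.up ℤ).prev p = q := ⟨p - 1, rfl, by simp⟩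
  let φ := (HomologicalComplex.shortComplexFunctor V (ComplexShape.up ℤ) p).map τ
  have : IsIso φ.τ₂ := h₁
  have : IsIso φ.τ₁ := by
    change IsIso (τ.f ((ComplexShape.up ℤ).prev p))
    rw [hq', hq]
    exact h₀
  exact inferInstanceAs (IsIso (ShortComplex.opcyclesMap φ))

lemma acyclic_mappingCone {K L : CochainComplex V ℤ} (f : K ⟶ L) [hf : QuasiIso f] :
    (mappingCone f).Acyclic := by
  rw [← HomotopyCategory.quotient_obj_mem_subcategoryAcyclic_iff_acyclic]
  refine ((HomotopyCategory.subcategoryAcyclic V).trW_iff_of_distinguished _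
    (HomotopyCategory.mappingCone_triangleh_distinguished f)).1 ?_
  rw [← HomotopyCategory.quasiIso_eq_trW_subcategoryAcyclic]
  exact (HomotopyCategory.quotient_map_mem_quasiIso_iff f).2 hf

lemma exists_mappingCone_hom_shift {K L : CochainComplex V ℤ} (f : K ⟶ L) :
    ∃ δ : mappingCone f ⟶ K⟦(1 : ℤ)⟧, ∀ p, IsZero (L.X p) → IsIso (δ.f p) := by
  let δ : mappingCone f ⟶ K⟦(1 : ℤ)⟧ := (mappingCone.triangle f).mor₃
  refine ⟨δ, fun p hp => ?_⟩
  let e : (K⟦(1 : ℤ)⟧).X p ≅ K.X (p + 1) := K.shiftFunctorObjXIso 1 p (p + 1) (by lia)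
  have hδ : (mappingCone.inl f).v (p + 1) p (by lia) ≫ δ.f p = -e.inv :=
    mappingCone.inl_v_triangle_mor₃_f f (p + 1) p (by lia)
  refine ⟨-(e.hom ≫ (mappingCone.inl f).v (p + 1) p (by lia)), ?_, ?_⟩
  · rw [mappingCone.ext_from_iff f (p + 1) p rfl]
    refine ⟨?_, hp.eq_of_src _ _⟩
    rw [reassoc_of% hδ, Preadditive.neg_comp_neg, Iso.inv_hom_id_assoc, Category.comp_id]
  · rw [Preadditive.neg_comp, Category.assoc, hδ, Preadditive.comp_neg, neg_neg, Iso.hom_inv_id]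

/-- The cokernel `C_l(P)` of a complex of projectives that is exact in degrees `≤ l` is projective
if `P` is DG-projective. -/
lemma projective_opcycles (P : CochainComplex V ℤ) [P.IsKProjective] (hP : ∀ p, Projective (P.X p))
    (j : ℤ) (h : ∀ p ≥ j, P.ExactAt p) : Projective (P.opcycles j) := by
  have hac : (P.truncGE j).Acyclic :=
    (P.acyclic_truncGE_iff (j - 1) j).2 ((P.isLE_iff _).2 fun i hi => h i (by lia))
  -- The truncation has `C(j)` in degree `j` and zero in degree `j - 1`. There a null-homotopy
  -- factors the projection `P^j → C(j)` through `d`, making `C(j)` a retract of `P^(j+1)`.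
  have H := IsKProjective.homotopyZero (P.πTruncGE j) hac
  obtain ⟨e, he⟩ : ∃ e : P.opcycles j ≅ (P.truncGE j).X j,
      (P.πTruncGE j).f j = P.pOpcycles j ≫ e.hom := by
    have hb : (ComplexShape.embeddingUpIntGE j).BoundaryGE 0 := by
      rw [ComplexShape.boundaryGE_embeddingUpIntGE_iff]
    have h0 : (ComplexShape.embeddingUpIntGE j).f 0 = j := by simp
    refine ⟨(P.truncGE'XIsoOpcycles _ h0 hb).symm ≪≫
      (HomologicalComplex.extendXIso _ _ h0).symm, ?_⟩
    dsimp only [CochainComplex.πTruncGE, HomologicalComplex.πTruncGE]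
    rw [ComplexShape.Embedding.liftExtend_f _ _ _ h0,
      HomologicalComplex.restrictionToTruncGE'_f_eq_iso_hom_pOpcycles_iso_inv _ _ h0 hb]
    simp
    rfl
  have := hP (j + 1)
  refine (Retract.mk (P.fromOpcycles j (j + 1)) (H.hom (j + 1) j ≫ e.inv) ?_).projective
  rw [← cancel_epi (P.pOpcycles j), P.p_fromOpcycles_assoc, Category.comp_id, ← cancel_mono e.hom,
    Category.assoc, Category.assoc, e.inv_hom_id, Category.comp_id, ← he, H.comm j,
    prevD_eq _ (show (ComplexShape.up ℤ).Rel (j - 1) j by simp),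
    dNext_eq _ (show (ComplexShape.up ℤ).Rel j (j + 1) by simp),
    ((P.truncGE j).isZero_of_isStrictlyGE j (j - 1)).eq_of_tgt (H.hom j (j - 1)) 0, zero_comp,
    add_zero, HomologicalComplex.zero_f, add_zero]

/-- Exactness identifies cycles with boundaries, so `0 → Z(p) → P^p → C(p) → 0` is exact and splits.
-/
lemma projective_cycles (P : CochainComplex V ℤ) (hP : ∀ p, Projective (P.X p)) (p : ℤ)
    (hE : P.ExactAt p) [Projective (P.opcycles p)] : Projective (P.cycles p) := by
  have hw : P.iCycles p ≫ P.pOpcycles p = 0 := by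
    rw [← P.homology_π_ι, hE.isZero_homology.eq_of_tgt (P.homologyπ p) 0, zero_comp]
  have hS : (ShortComplex.mk _ _ hw).ShortExact := by
    refine ShortComplex.ShortExact.mk' ?_ inferInstance inferInstance
    let S := ShortComplex.mk (P.d (p - 1) p) (P.pOpcycles p) (P.d_pOpcycles _ _)
    have hS : S.Exact :=
      S.exact_of_g_is_cokernel (P.opcyclesIsCokernel (p - 1) p (by simp))
    let T := ShortComplex.mk (P.iCycles p) (P.pOpcycles p) hw
    let φ : S ⟶ T :=
      { τ₁ := P.toCycles (p - 1) p
        τ₂ := 𝟙 _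
        τ₃ := 𝟙 _ }
    have : Epi φ.τ₁ := by
      have := (cyclesSequence_shortExact P (p - 1) p (by simp) hE).epi_g
      exact this
    have : IsIso φ.τ₂ := inferInstanceAs (IsIso (𝟙 _))
    have : Mono φ.τ₃ := inferInstanceAs (Mono (𝟙 _))
    exact (ShortComplex.exact_iff_of_epi_of_isIso_of_mono φ).1 hS
  have : Projective (ShortComplex.mk _ _ hw).X₃ := ‹_›
  have := hP p
  exact Retract.projective
    (Retract.mk (Y := P.X p) (P.iCycles p) hS.splittingOfProjective.r hS.splittingOfProjective.f_r)

end Transfer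

/-! ### Lifting derived isomorphisms to chain maps -/

section Resolutions

variable {R : Type u} [Ring R]

/-- A DG-projective complex linked with `A` by quasi-isomorphisms has a quasi-isomorphism to `A`. -/
lemma exists_quasiIso_of_equivalent {A X : Cplx R} (hA : Equivalent A X)
    (ρ : DGProjectiveResolution X) : ∃ f : ρ.P ⟶ A, QuasiIso f := by
  let := HasDerivedCategory.standard (ModuleCat.{u} R)
  obtain ⟨Z, f, g, hf, hg⟩ := hA
  have := ρ.dgProjective.2
  have := ρ.quasiIso
  let Q := DerivedCategory.Q (C := ModuleCat.{u} R)
  let eQ : Q.obj ρ.P ≅ Q.obj A :=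
    asIso (Q.map ρ.π) ≪≫ (asIso (Q.map g)).symm ≪≫ asIso (Q.map f)
  let e := DerivedCategory.quotientCompQhIso (ModuleCat.{u} R)
  obtain ⟨φ, hφ⟩ := (IsKProjective.Qh_map_bijective ρ.P
    ((HomotopyCategory.quotient _ _).obj A)).surjective (e.hom.app _ ≫ eQ.hom ≫ e.inv.app _)
  obtain ⟨φ, rfl⟩ := (HomotopyCategory.quotient _ _).map_surjective φ
  refine ⟨φ, ?_⟩
  rw [← DerivedCategory.isIso_Q_map_iff_quasiIso]
  have h : Q.map φ = eQ.hom := by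
    have := e.hom.naturality φ
    dsimp at this
    rw [← cancel_epi (e.hom.app ρ.P), ← this, hφ]
    simp only [Category.assoc, Iso.inv_hom_id_app]
    exact congr_arg _ (Category.comp_id _)
  change IsIso (Q.map φ)
  rw [h]
  infer_instance

end Resolutions

/-! ### Cokernels of complexes of Ding projective modules -/

section DingComplexes

variable {R : Type u} [Ring R]

lemma pOpcycles_surjective (K : Cplx R) (p : ℤ) : Function.Surjective (K.pOpcycles p) :=
  (ModuleCat.epi_iff_surjective _).1 inferInstance

lemma pOpcycles_eq_zero_iff (K : Cplx R) (q p : ℤ) (hqp : q + 1 = p) (x : K.X p) :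
    K.pOpcycles p x = 0 ↔ ∃ y, K.d q p y = x := by
  let S := ShortComplex.mk (K.d q p) (K.pOpcycles p) (K.d_pOpcycles _ _)
  have hS : S.Exact := S.exact_of_g_is_cokernel (K.opcyclesIsCokernel q p (by simp [← hqp]))
  refine ⟨(ShortComplex.moduleCat_exact_iff S).1 hS x, ?_⟩
  rintro ⟨y, rfl⟩
  exact ConcreteCategory.congr_hom S.zero y

lemma exactAt_apply {K : Cplx R} {q p r : ℤ} (hqp : q + 1 = p) (hpr : p + 1 = r)
    (h : K.ExactAt p) (x : K.X p) (hx : K.d p r x = 0) : ∃ y, K.d q p y = x := by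
  rw [HomologicalComplex.exactAt_iff' _ q p r (by simp [← hqp]) (by simp [← hpr])] at h
  exact (ShortComplex.moduleCat_exact_iff _).1 h x hx

lemma mappingCone_eq_inl_add_inr {K L : Cplx R} (f : K ⟶ L) (p q : ℤ) (hpq : p + 1 = q)
    (w : (mappingCone f).X p) :
    ∃ (x : K.X q) (a : L.X p),
      w = (mappingCone.inl f).v q p (by lia) x + (mappingCone.inr f).f p a :=
  ⟨(mappingCone.fst f).1.v p q hpq w, (mappingCone.snd f).v p p (add_zero p) w,
    (ConcreteCategory.congr_hom (mappingCone.id_X f p q hpq) w).symm⟩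

lemma mappingCone_inl_add_inr_inj {K L : Cplx R} (f : K ⟶ L) (p q : ℤ) (hpq : q + (-1) = p)
    {x x' : K.X q} {a a' : L.X p}
    (h : (mappingCone.inl f).v q p hpq x + (mappingCone.inr f).f p a =
      (mappingCone.inl f).v q p hpq x' + (mappingCone.inr f).f p a') : x = x' ∧ a = a' := by
  have h₁ (x : K.X q) : (mappingCone.fst f).1.v p q (by lia) ((mappingCone.inl f).v q p hpq x) = x :=
    ConcreteCategory.congr_hom (mappingCone.inl_v_fst_v f q p (by lia)) x
  have h₂ (a : L.X p) : (mappingCone.fst f).1.v p q (by lia) ((mappingCone.inr f).f p a) = 0 :=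
    ConcreteCategory.congr_hom (mappingCone.inr_f_fst_v f p q (by lia)) a
  have h₃ (x : K.X q) : (mappingCone.snd f).v p p (add_zero p) ((mappingCone.inl f).v q p hpq x) = 0 :=
    ConcreteCategory.congr_hom (mappingCone.inl_v_snd_v f q p hpq) x
  have h₄ (a : L.X p) : (mappingCone.snd f).v p p (add_zero p) ((mappingCone.inr f).f p a) = a :=
    ConcreteCategory.congr_hom (mappingCone.inr_f_snd_v f p) a
  refine ⟨?_, ?_⟩
  · simpa only [map_add, h₁, h₂, add_zero] using
      congr_arg ((mappingCone.fst f).1.v p q (by lia)) h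
  · simpa only [map_add, h₃, h₄, zero_add] using
      congr_arg ((mappingCone.snd f).v p p (add_zero p)) h

lemma mappingCone_d_inl_add_inr {K L : Cplx R} (f : K ⟶ L) (p q r : ℤ) (hpq : p + 1 = q)
    (hqr : q + 1 = r) (x : K.X q) (a : L.X p) :
    (mappingCone f).d p q ((mappingCone.inl f).v q p (by lia) x + (mappingCone.inr f).f p a) =
      (mappingCone.inl f).v r q (by lia) (-K.d q r x) +
        (mappingCone.inr f).f q (f.f q x + L.d p q a) := by
  have h₁ := ConcreteCategory.congr_hom
    (mappingCone.inl_v_d f q p r (by lia) (by lia)) x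
  have h₂ := ConcreteCategory.congr_hom (mappingCone.inr_f_d f p q) a
  change (mappingCone f).d p q ((mappingCone.inl f).v q p (by lia) x) =
    (mappingCone.inr f).f q (f.f q x) - (mappingCone.inl f).v r q (by lia) (K.d q r x) at h₁
  change (mappingCone f).d p q ((mappingCone.inr f).f p a) =
    (mappingCone.inr f).f q (L.d p q a) at h₂
  rw [map_add, h₁, h₂, map_neg, map_add]
  abel

/-- The sequence `0 → C_l(P) → C_l(A) ⊕ P_{l-1} → C_l(Cone f) → 0` for a quasi-isomorphism
`f : P → A`. -/
lemma exists_opcycles_mappingCone_shortExact {P A : Cplx R} (f : P ⟶ A) [QuasiIso f] (p r : ℤ)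
    (hpr : p + 1 = r) :
    ∃ S : ShortComplex (ModuleCat.{u} R), S.ShortExact ∧ S.X₁ = P.opcycles p ∧
      S.X₂ = ModuleCat.of R (A.opcycles p × P.X r) ∧ S.X₃ = (mappingCone f).opcycles p := by
  obtain ⟨q, hqp⟩ : ∃ q, q + 1 = p := ⟨p - 1, by lia⟩
  obtain ⟨o, hoq⟩ : ∃ o, o + 1 = q := ⟨q - 1, by lia⟩
  let W := mappingCone f
  let ι : P.X r ⟶ W.X p := (mappingCone.inl f).v r p (by lia)
  let u : P.opcycles p →ₗ[R] A.opcycles p × P.X r :=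
    (HomologicalComplex.opcyclesMap f p).hom.prod (-(P.fromOpcycles p r).hom)
  let v : A.opcycles p × P.X r →ₗ[R] W.opcycles p :=
    (HomologicalComplex.opcyclesMap (mappingCone.inr f) p).hom.coprod (ι ≫ W.pOpcycles p).hom
  have hu (x : P.X p) : u (P.pOpcycles p x) = (A.pOpcycles p (f.f p x), -P.d p r x) :=
    Prod.ext (ConcreteCategory.congr_hom (HomologicalComplex.p_opcyclesMap f p) x)
      (congr_arg (fun y => -y) (ConcreteCategory.congr_hom (P.p_fromOpcycles p r) x))
  have hv (a : A.X p) (y : P.X r) :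
      v (A.pOpcycles p a, y) = W.pOpcycles p (ι y + (mappingCone.inr f).f p a) := by
    rw [map_add, add_comm (W.pOpcycles p (ι y))]
    exact congr_arg (· + W.pOpcycles p (ι y))
      (ConcreteCategory.congr_hom (HomologicalComplex.p_opcyclesMap (mappingCone.inr f) p) a)
  obtain ⟨w, hw⟩ := shortExact_ofHom u v
    (by
      rw [injective_iff_map_eq_zero]
      intro x hx
      obtain ⟨x, rfl⟩ := pOpcycles_surjective P p x
      rw [hu, Prod.mk_eq_zero, pOpcycles_eq_zero_iff A q p hqp, neg_eq_zero] at hx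
      obtain ⟨⟨b, hb⟩, hx⟩ := hx
      -- If `f x = d b` and `d x = 0`, then `(x, -b)` is a cycle of the cone. The cone is acyclic
      -- since `f` is a quasi-isomorphism, so `x` is a boundary.
      obtain ⟨w, hw⟩ := exactAt_apply hoq hqp (acyclic_mappingCone f q)
        ((mappingCone.inl f).v p q (by lia) x + (mappingCone.inr f).f q (-b)) (by
          rw [mappingCone_d_inl_add_inr f q p r hqp hpr, hx, neg_zero, map_zero, zero_add,
            map_neg (A.d q p).hom, hb, add_neg_cancel, map_zero])
      obtain ⟨y, c, rfl⟩ := mappingCone_eq_inl_add_inr f o q hoq w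
      rw [mappingCone_d_inl_add_inr f o q p hoq hqp] at hw
      rw [pOpcycles_eq_zero_iff P q p hqp]
      refine ⟨-y, ?_⟩
      rw [map_neg]
      exact (mappingCone_inl_add_inr_inj f q p (by lia) hw).1)
    (by
      intro w
      obtain ⟨w, rfl⟩ := pOpcycles_surjective W p w
      obtain ⟨x, a, rfl⟩ := mappingCone_eq_inl_add_inr f p r hpr w
      exact ⟨_, hv a x⟩)
    (by
      intro x
      obtain ⟨x, rfl⟩ := pOpcycles_surjective P p x
      rw [hu, hv, pOpcycles_eq_zero_iff W q p hqp]
      refine ⟨(mappingCone.inl f).v p q (by lia) x + (mappingCone.inr f).f q 0, ?_⟩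
      rw [mappingCone_d_inl_add_inr f q p r hqp hpr, map_zero, add_zero])
    (by
      rintro ⟨a, y⟩ h
      obtain ⟨a, rfl⟩ := pOpcycles_surjective A p a
      rw [hv, pOpcycles_eq_zero_iff W q p hqp] at h
      obtain ⟨w, hw⟩ := h
      obtain ⟨x, b, rfl⟩ := mappingCone_eq_inl_add_inr f q p hqp w
      rw [mappingCone_d_inl_add_inr f q p r hqp hpr] at hw
      obtain ⟨rfl, rfl⟩ := mappingCone_inl_add_inr_inj f p r (by lia) hw
      refine ⟨P.pOpcycles p x, ?_⟩
      have hb : A.pOpcycles p (A.d q p b) = 0 := (pOpcycles_eq_zero_iff A q p hqp _).2 ⟨b, rfl⟩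
      rw [hu, map_add, hb, add_zero])
  exact ⟨_, hw, rfl, rfl, rfl⟩

lemma DingProjective.mappingCone_X {P A : Cplx R} (f : P ⟶ A) (hP : ∀ p, Projective (P.X p))
    (hA : ∀ p, DingProjective (A.X p)) (p : ℤ) : DingProjective ((mappingCone f).X p) := by
  have := hP (p + 1)
  let S : ShortComplex (ModuleCat.{u} R) := ShortComplex.mk ((mappingCone.inr f).f p)
    ((mappingCone.fst f).1.v p (p + 1) rfl) (mappingCone.inr_f_fst_v f p (p + 1) rfl)
  let s : S.Splitting :=
    { r := (mappingCone.snd f).v p p (add_zero p)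
      s := (mappingCone.inl f).v (p + 1) p (by lia)
      f_r := mappingCone.inr_f_snd_v f p
      s_g := mappingCone.inl_v_fst_v f (p + 1) p (by lia)
      id := by
        rw [add_comm]
        exact mappingCone.id_X f p (p + 1) rfl }
  have h := DingProjective.of_extension s.shortExact (hA p) (dingProjective_of_projective (P.X (p + 1)))
  exact h

lemma dingProjective_opcycles_of_acyclic {W : Cplx R} (hW : W.Acyclic)
    (hX : ∀ p, DingProjective (W.X p)) (b : ℤ) (hb : DingProjective (W.opcycles b)) (p : ℤ)
    (hp : p ≤ b) : DingProjective (W.opcycles p) := by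
  induction p, hp using Int.leInductionDown with
  | base => exact hb
  | pred p _ ih =>
    have h := DingProjective.of_shortExact
      (opcyclesSequence_shortExact W (p - 1) p (by lia) (hW _)) (hX p) ih
    exact h

/-- Beyond degree `b` the cone coincides with `P[1]`, whose cokernels there are projective because
`P` is exact and K-projective. Acyclicity carries the property down through kernels of epimorphisms.
-/
lemma dingProjective_opcycles_mappingCone {P A : Cplx R} (f : P ⟶ A) [QuasiIso f]
    [P.IsKProjective] (hP : ∀ p, Projective (P.X p)) (hA : ∀ p, DingProjective (A.X p))
    (b : ℤ) (hPb : ∀ p > b, P.ExactAt p) (hAb : ∀ p > b, IsZero (A.X p)) (p : ℤ) :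
    DingProjective ((mappingCone f).opcycles p) := by
  obtain ⟨δ, hδ⟩ := exists_mappingCone_hom_shift f
  -- The cokernel in degree `j` involves degrees `j - 1` and `j`, and both must exceed `b`.
  have hbase (j : ℤ) (hj : b + 2 ≤ j) : DingProjective ((mappingCone f).opcycles j) := by
    have := isIso_opcyclesMap_of_isIso δ j (hδ _ (hAb _ (by lia))) (hδ _ (hAb _ (by lia)))
    have := projective_opcycles (P⟦(1 : ℤ)⟧) (fun q => hP _) j fun q hq => by
      rw [HomologicalComplex.exactAt_iff_isZero_homology]
      exact (hPb (q + 1) (by lia)).isZero_homology.of_iso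
        (((HomologicalComplex.homologyFunctor _ (ComplexShape.up ℤ) 0).shiftIso 1 q (q + 1)
          (by lia)).app P)
    exact (dingProjective_of_projective _).of_iso (asIso (HomologicalComplex.opcyclesMap δ j)).symm
  exact dingProjective_opcycles_of_acyclic (acyclic_mappingCone f)
    (DingProjective.mappingCone_X f hP hA) (max p (b + 2)) (hbase _ (by lia)) p (by lia)

/-- If `C_l(P)` is Ding projective, so is `C_l(A)` for every bounded below complex `A` of Ding
projective modules that receives a quasi-isomorphism from the DG-projective complex `P`. -/
theorem dingProjective_opcycles_of_quasiIso {P A : Cplx R} (f : P ⟶ A) [QuasiIso f]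
    [P.IsKProjective] (hP : ∀ p, Projective (P.X p)) (hA : ∀ p, DingProjective (A.X p))
    (b : ℤ) (hPb : ∀ p > b, P.ExactAt p) (hAb : ∀ p > b, IsZero (A.X p)) (p : ℤ)
    (h : DingProjective (P.opcycles p)) : DingProjective (A.opcycles p) := by
  obtain ⟨S, hS, h₁, h₂, h₃⟩ := exists_opcycles_mappingCone_shortExact f p (p + 1) rfl
  have hS₂ := DingProjective.of_extension hS (h₁ ▸ h)
    (h₃ ▸ dingProjective_opcycles_mappingCone f hP hA b hPb hAb p)
  rw [h₂] at hS₂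
  -- The extra projective summand is removed by taking the kernel of the projection onto it.
  obtain ⟨w, hw⟩ := shortExact_ofHom (LinearMap.inl R (A.opcycles p) (P.X (p + 1)))
    (LinearMap.snd R (A.opcycles p) (P.X (p + 1))) LinearMap.inl_injective
    LinearMap.snd_surjective (fun _ => rfl) (by
      rintro ⟨a, y⟩ rfl
      exact ⟨a, rfl⟩)
  have : Projective (ShortComplex.mk _ _ w).X₃ := hP (p + 1)
  have h := DingProjective.of_shortExact_of_projective hw hS₂
  exact h

end DingComplexes

/-! ### Arithmetic of extended integers -/

section ExtendedIntegers

lemma toE_sub_le_toE_iff (s n : ℤ) (y : EReal) : toE s - y ≤ toE n ↔ toE (s - n) ≤ y := by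
  induction y with
  | bot =>
    rw [toE, EReal.coe_sub_bot]
    simp only [top_le_iff, le_bot_iff, toE, EReal.coe_ne_top, EReal.coe_ne_bot]
  | top => simp [toE]
  | coe y =>
    rw [toE, toE, toE, ← EReal.coe_sub, EReal.coe_le_coe_iff, EReal.coe_le_coe_iff, sub_le_iff_le_add,
      Int.cast_sub, sub_le_iff_le_add, add_comm]

lemma toE_sub_lt_toE_iff (s n : ℤ) (y : EReal) : toE s - y < toE n ↔ toE (s - n) < y := by
  induction y with
  | bot => simp [toE]
  | top =>
    rw [EReal.sub_top]
    exact iff_of_true (EReal.bot_lt_coe _) (EReal.coe_lt_top _)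
  | coe y =>
    rw [toE, toE, toE, ← EReal.coe_sub, EReal.coe_lt_coe_iff, EReal.coe_lt_coe_iff, sub_lt_iff_lt_add,
      Int.cast_sub, sub_lt_iff_lt_add, add_comm]

lemma toE_zero : toE 0 = 0 := by simp [toE]

/-- A bound of the shape `D ≤ n ↔ e ≤ n for all e ∈ S` for all integers `n` identifies the infimum
`D` of a set of integers with the supremum of a set `S` of extended integers. -/
lemma sInf_toE_eq_sSup (Z : Set ℤ) (S : Set EReal)
    (hS : ∀ e ∈ S, ∀ k : ℤ, e < toE (k + 1) → e ≤ toE k)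
    (h : ∀ n : ℤ, sInf (toE '' Z) ≤ toE n ↔ ∀ e ∈ S, e ≤ toE n) :
    sInf (toE '' Z) = sSup S := by
  apply le_antisymm
  · refine EReal.le_of_forall_lt_iff_le.1 fun r hr => ?_
    -- Integrality of the elements of `S` rounds a real bound down to its floor, where the
    -- equivalence for integers applies.
    have hr' : sSup S ≤ toE ⌊r⌋ := sSup_le fun e he => hS e he _
      (((le_sSup he).trans_lt hr).trans (EReal.coe_lt_coe_iff.2 (by
        push_cast
        exact Int.lt_floor_add_one r)))
    exact ((h _).2 fun e he => (le_sSup he).trans hr').trans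
      (EReal.coe_le_coe_iff.2 (Int.floor_le r))
  · refine le_sInf ?_
    rintro _ ⟨k, hk, rfl⟩
    exact sSup_le fun e he => (h k).1 (sInf_le ⟨k, hk, rfl⟩) e he

variable {V : Type*} [Category V] [Abelian V]

lemma toE_le_infH_iff (X : CochainComplex V ℤ) (k : ℤ) :
    toE k ≤ infH X ↔ ∀ l < k, IsZero (hl X l) := by
  rw [infH, le_sInf_iff, Set.forall_mem_image]
  refine ⟨fun h l hlk => ?_, fun h l hl => ?_⟩
  · by_contra hne
    exact absurd (toE_le_toE.1 (h hne)) (by lia)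
  · by_contra hlt
    rw [toE_le_toE, not_le] at hlt
    exact hl (h l hlt)

lemma supH_le_toE_iff (X : CochainComplex V ℤ) (k : ℤ) :
    supH X ≤ toE k ↔ ∀ l > k, IsZero (hl X l) := by
  rw [supH, sSup_le_iff, Set.forall_mem_image]
  refine ⟨fun h l hlk => ?_, fun h l hl => ?_⟩
  · by_contra hne
    exact absurd (toE_le_toE.1 (h hne)) (by lia)
  · by_contra hlt
    rw [toE_le_toE, not_le] at hlt
    exact hl (h l hlt)

lemma exists_infH_eq (X : CochainComplex V ℤ) (h : HomologicallyBoundedBelow X)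
    (hX : HomologyNonzero X) : ∃ s : ℤ, infH X = toE s ∧ ∀ l < s, IsZero (hl X l) := by
  obtain ⟨N, hN⟩ := h
  obtain ⟨s, hs, hs'⟩ := Int.exists_least_of_bdd (P := fun l => ¬ IsZero (hl X l))
    ⟨N, fun l hl => by
      by_contra hlt
      exact hl (hN l (by lia))⟩ hX
  have hlt (l : ℤ) (hls : l < s) : IsZero (hl X l) := by
    by_contra hne
    exact absurd (hs' l hne) (by lia)
  exact ⟨s, le_antisymm (sInf_le ⟨s, hs, rfl⟩) ((toE_le_infH_iff X s).2 hlt), hlt⟩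

end ExtendedIntegers

/-! ### Numerical invariants as vanishing conditions -/

section Invariants

variable {R : Type u} [Ring R]

lemma toE_le_infRHom_iff (X U : Cplx R) (k : ℤ) :
    toE k ≤ infRHom X U ↔ ∀ ρ : DGProjectiveResolution X, ∀ l < k, IsZero (hl (RHom ρ U) l) := by
  rw [infRHom, le_iInf_iff]
  exact forall_congr' fun ρ => toE_le_infH_iff _ _

lemma toE_sub_infRHom_le_iff (X U : Cplx R) (s n : ℤ) :
    toE s - infRHom X U ≤ toE n ↔
      ∀ ρ : DGProjectiveResolution X, ∀ m > n - s, IsZero ((RHom ρ U).homology m) := by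
  rw [toE_sub_le_toE_iff, toE_le_infRHom_iff]
  refine forall_congr' fun ρ => ⟨fun h m hm => ?_, fun h l hl => h (-l) (by lia)⟩
  obtain ⟨l, rfl⟩ : ∃ l, m = -l := ⟨-m, by lia⟩
  exact h l (by lia)

/-- This is the integrality required in `sInf_toE_eq_sSup`; it also covers infinite values of
`infRHom`. -/
lemma toE_sub_infRHom_le_of_lt (X U : Cplx R) (s k : ℤ)
    (h : toE s - infRHom X U < toE (k + 1)) : toE s - infRHom X U ≤ toE k := by
  rw [toE_sub_lt_toE_iff] at h
  rw [toE_sub_le_toE_iff, toE_le_infRHom_iff]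
  intro ρ l hl
  by_contra hne
  have hle : infRHom X U ≤ toE l := (iInf_le _ ρ).trans (sInf_le ⟨l, hne, rfl⟩)
  exact absurd (toE_lt_toE.1 (h.trans_le hle)) (by lia)

lemma neg_infRHom_le_iff (X U : Cplx R) (n : ℤ) :
    -infRHom X U ≤ toE n ↔
      ∀ ρ : DGProjectiveResolution X, ∀ m > n, IsZero ((RHom ρ U).homology m) := by
  have := toE_sub_infRHom_le_iff X U 0 n
  rwa [toE_zero, zero_sub, sub_zero] at this

/-- The infimum may be `-∞` and not attained, but being below `n + 1` it is beaten by some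
admissible integer `k ≤ n`. -/
lemma Dpd_le_toE_iff (X : Cplx R) (n : ℤ) :
    Dpd X ≤ toE n ↔ ∃ κ : FCompleteResolution X, ∀ i ≥ n, Function.Bijective (κ.τ.f (-i)) := by
  constructor
  · intro h
    obtain ⟨_, ⟨k, ⟨κ, hκ⟩, rfl⟩, hk⟩ := sInf_lt_iff.1
      (h.trans_lt (toE_lt_toE.2 (Int.lt_succ n)))
    have := toE_lt_toE.1 hk
    exact ⟨κ, fun i hi => hκ i (by lia)⟩
  · exact fun h => sInf_le ⟨n, h, rfl⟩

lemma isZero_RHom_stalk_homology {X : Cplx R} (ρ : DGProjectiveResolution X)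
    {F : ModuleCat.{u} R} (hF : IsZero F) (m : ℤ) : IsZero ((RHom ρ (stalk F)).homology m) :=
  (isZero_homCplx_stalk_homology_iff ρ.P F m (-m) (by lia)).2 (homExactAt_of_isZero _ hF _)

lemma isZero_stalk_X (F : ModuleCat.{u} R) (p : ℤ) (hp : p ≠ 0) : IsZero ((stalk F).X p) :=
  HomologicalComplex.isZero_single_obj_X (ComplexShape.up ℤ) 0 F p hp

lemma isZero_hl_stalk (F : ModuleCat.{u} R) (l : ℤ) (hl : l ≠ 0) : IsZero (DingDim.hl (stalk F) l) :=
  ((HomologicalComplex.exactAt_single_obj (ComplexShape.up ℤ) 0 F (-l) (by lia))).isZero_homology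

lemma flatDim_stalk_lt_top {F : ModuleCat.{u} R} (hF : IsFlat R F) : flatDim (stalk F) < ⊤ := by
  have hmem : stalk F ∈ {K : Cplx R | Equivalent K (stalk F) ∧ BoundedBelow K ∧
      ∀ l, IsFlat R (comp K l : ModuleCat.{u} R)} := by
    refine ⟨Equivalent.refl _, ⟨0, fun l hl => isZero_stalk_X F _ (by lia)⟩, fun l => ?_⟩
    by_cases hl : -l = 0
    · rw [comp, hl]
      exact hF.of_iso (HomologicalComplex.singleObjXSelf (ComplexShape.up ℤ) 0 F).symm
    · exact isFlat_of_isZero _ (isZero_stalk_X F _ hl)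
  have hle : flatDim (stalk F) ≤ supComp (stalk F) := sInf_le ⟨_, hmem, rfl⟩
  refine lt_of_le_of_lt (b := toE 0) (hle.trans (sSup_le ?_)) (by simp [toE])
  rintro _ ⟨l, hl, rfl⟩
  rw [toE_le_toE]
  by_contra hlt
  exact hl (isZero_stalk_X F _ (by lia))

lemma finiteFlatNonzero_stalk {F : ModuleCat.{u} R} (hF : IsFlat R F) (h : ¬ IsZero F) :
    FiniteFlatNonzero (stalk F) := by
  refine ⟨⟨⟨0, fun l hl => isZero_hl_stalk F l (by lia)⟩, ⟨0, fun l hl => isZero_hl_stalk F l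
    (by lia)⟩⟩, flatDim_stalk_lt_top hF, 0, fun h0 => h ?_⟩
  exact h0.of_iso (HomologicalComplex.singleObjHomologySelfIso (ComplexShape.up ℤ) 0 F).symm

lemma infH_stalk {F : ModuleCat.{u} R} (h : ¬ IsZero F) : infH (stalk F) = toE 0 := by
  refine le_antisymm (sInf_le ⟨0, fun h0 => h ?_, rfl⟩)
    ((toE_le_infH_iff _ _).2 fun l hl => isZero_hl_stalk F l (by lia))
  exact h0.of_iso (HomologicalComplex.singleObjHomologySelfIso (ComplexShape.up ℤ) 0 F).symm

end Invariants

/-! ### The individual implications -/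

section Implications

variable {R : Type u} [Ring R] {X : Cplx R}

lemma DGProjectiveResolution.exactAt (ρ : DGProjectiveResolution X) (p : ℤ) :
    ρ.P.ExactAt p ↔ X.ExactAt p := by
  have := ρ.quasiIso
  exact ⟨fun h => (quasiIsoAt_iff_exactAt ρ.π p h).1 inferInstance,
    fun h => (quasiIsoAt_iff_exactAt' ρ.π p h).1 inferInstance⟩

theorem exists_completeResolution_of_isZero_homology (κ : FCompleteResolution X) (n : ℤ)
    (h : ∀ F : ModuleCat.{u} R, IsFlat R F → ∀ m > n,
      IsZero ((RHom κ.res (stalk F)).homology m)) :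
    ∃ κ' : FCompleteResolution X, ∀ i ≥ n, Function.Bijective (κ'.τ.f (-i)) := by
  obtain ⟨N, hN⟩ := κ.eventually_bijective
  obtain ⟨T', τ', hT', hτ'⟩ := exists_totallyFAcyclic_of_homExactAt κ.totallyFAcyclic
    κ.res.dgProjective.projective_X κ.τ (-N) (isIso_of_bijective_neg κ.τ N hN) (-n)
    fun F hF p hp => (isZero_homCplx_stalk_homology_iff κ.res.P F (-p) p (by lia)).1
      (h F hF _ (by lia))
  have hbij := bijective_neg_of_isIso τ' n hτ'
  exact ⟨⟨T', κ.res, τ', hT', n, hbij⟩, hbij⟩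

lemma isZero_hl_of_completeResolution (κ : FCompleteResolution X) (n : ℤ)
    (hκ : ∀ i ≥ n, Function.Bijective (κ.τ.f (-i))) (l : ℤ) (hl : l > n) :
    IsZero (DingDim.hl X l) := by
  have hiso := isIso_of_bijective_neg κ.τ n hκ
  exact ((κ.res.exactAt _).1 (exactAt_of_isIso κ.τ (-l) (κ.totallyFAcyclic.acyclic _)
    (hiso _ (by lia)) (hiso _ (by lia)) (hiso _ (by lia)))).isZero_homology

/-- `τ` is bijective in homological degrees `n` and `n + 1`, so `C_n(P) ≅ C_n(T)` is Ding
projective; a quasi-isomorphism `P → A` then transfers this to `A`. -/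
theorem dingProjective_coker_of_completeResolution (hX : HomologicallyBoundedBelow X)
    (κ : FCompleteResolution X) (n : ℤ) (hκ : ∀ i ≥ n, Function.Bijective (κ.τ.f (-i)))
    {A : Cplx R} (hA : BoundedBelow A) (hAX : Equivalent A X)
    (hA' : ∀ l, DingProjective (comp A l)) : DingProjective (coker A n) := by
  obtain ⟨N, hN⟩ := hX
  obtain ⟨M, hM⟩ := hA
  obtain ⟨f, hf⟩ := exists_quasiIso_of_equivalent hAX κ.res
  have := κ.res.dgProjective.2
  have hiso := isIso_of_bijective_neg κ.τ n hκ
  have hτ := isIso_opcyclesMap_of_isIso κ.τ (-n) (hiso _ (by lia)) (hiso _ le_rfl)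
  refine DingProjective.of_iso ?_ (cokerIsoOpcycles A n (-n) rfl).symm
  refine dingProjective_opcycles_of_quasiIso f κ.res.dgProjective.projective_X (fun p => ?_)
    (max (-N) (-M)) (fun p hp => ?_) (fun p hp => ?_) (-n)
    ((κ.totallyFAcyclic.dingProjective_opcycles (-n)).of_iso
      (asIso (HomologicalComplex.opcyclesMap κ.τ (-n))))
  · have := hA' (-p)
    rwa [comp, neg_neg] at this
  · exact (κ.res.exactAt p).2 (exactAt_of_isZero_hl (hN (-p) (by lia)) (by lia))
  · have := hM (-p) (by lia)
    rwa [comp, neg_neg] at this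

/-- A homologically bounded below complex with a DG-projective resolution has one that is bounded
below. -/
lemma exists_boundedBelow_resolution (hX : HomologicallyBoundedBelow X)
    (ρ : DGProjectiveResolution X) : ∃ ρ' : DGProjectiveResolution X, BoundedBelow ρ'.P := by
  obtain ⟨N, hN⟩ := hX
  -- With this offset `P` is exact at `j` itself, as projectivity of the cycles in degree `j`
  -- requires.
  let j := -N + 1
  have hE (p : ℤ) (hp : p ≥ j) : ρ.P.ExactAt p :=
    (ρ.exactAt p).2 (exactAt_of_isZero_hl (hN (-p) (by lia)) (by lia))
  have hP := ρ.dgProjective.projective_X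
  have := ρ.dgProjective.2
  have := ρ.quasiIso
  have : Projective (ρ.P.opcycles j) := projective_opcycles ρ.P hP j hE
  have : Projective (ρ.P.cycles j) := projective_cycles ρ.P hP j (hE j le_rfl)
  have : ρ.P.IsLE j := (ρ.P.isLE_iff j).2 fun i hi => hE i hi.le
  have hP' (p : ℤ) : Projective ((ρ.P.truncLE j).X p) := by
    rcases lt_trichotomy p j with hp | rfl | hp
    · have := hP p
      exact Projective.of_iso (ρ.P.truncLEXIso j p hp).symm this
    · exact Projective.of_iso (ρ.P.truncLEXIsoCycles j).symm ‹_›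
    · exact ((ρ.P.truncLE j).isZero_of_isStrictlyLE j p hp).projective
  exact ⟨⟨ρ.P.truncLE j, ρ.P.ιTruncLE j ≫ ρ.π,
    ⟨fun l => hP' _, isKProjective_of_projective _ j⟩, inferInstance⟩,
    -j, fun l hl => (ρ.P.truncLE j).isZero_of_isStrictlyLE j (-l) (by lia)⟩

/-- The hypothesis is used only for a bounded below projective resolution. Its `C_l` with `l ≥ n`
are iterated syzygies of `C_n` and inherit `Ext` vanishing, which makes `Hom(-, F)` exact in the
required degrees. -/
theorem isZero_RHom_homology_of_dingProjective_coker (hX : HomologicallyBoundedBelow X) (n : ℤ)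
    (hsup : ∀ l > n, IsZero (hl X l))
    (h : ∀ A : Cplx R, BoundedBelow A → Equivalent A X → (∀ l, DingProjective (comp A l)) →
      DingProjective (coker A n))
    {F : ModuleCat.{u} R} (hF : IsFlat R F) (ρ : DGProjectiveResolution X) (m : ℤ) (hm : m > n) :
    IsZero ((RHom ρ (stalk F)).homology m) := by
  obtain ⟨ρ', hρ'⟩ := exists_boundedBelow_resolution hX ρ
  have hP := ρ'.dgProjective.projective_X
  have := ρ'.quasiIso
  have hC := (h ρ'.P hρ' (equivalent_of_quasiIso ρ'.π) fun l =>
    have := hP (-l)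
    dingProjective_of_projective _).extVanish.of_iso (cokerIsoOpcycles ρ'.P n (-n) rfl)
  have hE (p : ℤ) (hp : p < -n) : ρ'.P.ExactAt p :=
    (ρ'.exactAt p).2 (exactAt_of_isZero_hl (hsup (-p) (by lia)) (by lia))
  have hV (p : ℤ) (hp : p ≤ -n) : ExtVanish (ρ'.P.opcycles p) := by
    induction p, hp using Int.leInductionDown with
    | base => exact hC
    | pred p _ ih =>
      have := hP p
      have h := ExtVanish.left (opcyclesSequence_shortExact ρ'.P (p - 1) p (by lia)
        (hE _ (by lia))) (extVanish_of_projective (ρ'.P.X p)) ih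
      exact h
  rw [isZero_RHom_homology_congr ρ ρ' (Equivalent.refl _),
    isZero_homCplx_stalk_homology_iff ρ'.P F m (-m) (by lia)]
  exact homExactAt_of_extVanish_opcycles ρ'.P (-m) (-m + 1) rfl (hE _ (by lia))
    (hV _ (by lia)) hF

end Implications

end DingDim

end


/-! ### The main theorem -/

theorem mainTheorem3 {R : Type u} [Ring R] (X : DingDim.Cplx R)
    (hX : DingDim.HomologicallyBoundedBelow X) (hfin : DingDim.Dpd X < ⊤) :
    (∀ n : ℤ, List.TFAE
      [DingDim.Dpd X ≤ DingDim.toE n,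
       ∀ U : DingDim.Cplx R, DingDim.FiniteFlatNonzero U →
        DingDim.infH U - DingDim.infRHom X U ≤ DingDim.toE n,
       ∀ F : ModuleCat.{u} R, DingDim.IsFlat R F →
        - DingDim.infRHom X (DingDim.stalk F) ≤ DingDim.toE n,
       DingDim.supH X ≤ DingDim.toE n ∧
        ∀ A : DingDim.Cplx R, DingDim.BoundedBelow A → DingDim.Equivalent A X →
          (∀ l, DingDim.DingProjective (DingDim.comp A l)) →
          DingDim.DingProjective (DingDim.coker A n)]) ∧
    DingDim.Dpd X =
      sSup {e : EReal | ∃ U : DingDim.Cplx R, DingDim.FiniteFlatNonzero U ∧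
        e = DingDim.infH U - DingDim.infRHom X U} ∧
    DingDim.Dpd X =
      sSup {e : EReal | ∃ F : ModuleCat.{u} R, DingDim.IsFlat R F ∧
        e = - DingDim.infRHom X (DingDim.stalk F)} := by
  open DingDim in
  obtain ⟨N, hN⟩ := exists_int_of_lt_top hfin
  obtain ⟨κ, -⟩ := (Dpd_le_toE_iff X N).1 hN.le
  have h : ∀ n : ℤ, List.TFAE
      [Dpd X ≤ toE n,
       ∀ U : Cplx R, FiniteFlatNonzero U → infH U - infRHom X U ≤ toE n,
       ∀ F : ModuleCat.{u} R, IsFlat R F → - infRHom X (stalk F) ≤ toE n,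
       supH X ≤ toE n ∧ ∀ A : Cplx R, BoundedBelow A → Equivalent A X →
          (∀ l, DingProjective (comp A l)) → DingProjective (coker A n)] := by
    intro n
    tfae_have 1 → 2 := by
      intro h U hU
      obtain ⟨κ, hκ⟩ := (Dpd_le_toE_iff X n).1 h
      obtain ⟨s, hs, hs'⟩ := exists_infH_eq U hU.1.1 hU.2.2
      rw [hs, toE_sub_infRHom_le_iff]
      exact fun ρ m hm => isZero_RHom_homology_of_flatDim κ n hκ hU.2.1 s hs' ρ m hm
    tfae_have 2 → 3 := by
      intro h F hF
      by_cases hF' : CategoryTheory.Limits.IsZero F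
      -- The zero module is excluded from (2) by the condition on homology, so it is treated
      -- directly.
      · exact (neg_infRHom_le_iff X _ n).2 fun ρ m _ => isZero_RHom_stalk_homology ρ hF' m
      · simpa only [infH_stalk hF', toE_zero, zero_sub] using
          h (stalk F) (finiteFlatNonzero_stalk hF hF')
    tfae_have 3 → 1 := fun h => (Dpd_le_toE_iff X n).2
      (exists_completeResolution_of_isZero_homology κ n fun F hF m hm =>
        (neg_infRHom_le_iff X _ n).1 (h F hF) κ.res m hm)
    tfae_have 1 → 4 := by
      intro h
      obtain ⟨κ, hκ⟩ := (Dpd_le_toE_iff X n).1 h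
      exact ⟨(supH_le_toE_iff X n).2 (isZero_hl_of_completeResolution κ n hκ),
        fun A hA hAX hA' => dingProjective_coker_of_completeResolution hX κ n hκ hA hAX hA'⟩
    tfae_have 4 → 3 := fun h F hF => (neg_infRHom_le_iff X _ n).2
      (isZero_RHom_homology_of_dingProjective_coker hX n ((supH_le_toE_iff X n).1 h.1) h.2 hF)
    tfae_finish
  refine ⟨h, sInf_toE_eq_sSup _ _ ?_ fun n => ?_, sInf_toE_eq_sSup _ _ ?_ fun n => ?_⟩
  · rintro _ ⟨U, hU, rfl⟩ k
    obtain ⟨s, hs, -⟩ := exists_infH_eq U hU.1.1 hU.2.2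
    rw [hs]
    exact toE_sub_infRHom_le_of_lt X U s k
  · refine ((h n).out 0 1).trans ⟨?_, fun h U hU => h _ ⟨U, hU, rfl⟩⟩
    rintro h _ ⟨U, hU, rfl⟩
    exact h U hU
  · rintro _ ⟨F, -, rfl⟩ k
    simpa only [toE_zero, zero_sub] using toE_sub_infRHom_le_of_lt X (stalk F) 0 k
  · refine ((h n).out 0 2).trans ⟨?_, fun h F hF => h _ ⟨F, hF, rfl⟩⟩
    rintro h _ ⟨F, hF, rfl⟩
    exact h F hF
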